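/- Let $V$ and $H$ be complex Hilbert spaces such that $V$ is a dense subspace of $H$ with continuous inclusion, and let $V'$ be the antidual of $V$, so that $V\hookrightarrow H\hookrightarrow V'$, where $h\in H$ is identified with the functional $v\mapsto\langle h,v\rangle_H$ (scalar products are linear in the first argument). Let $\mathcal E\colon V\times V\to\mathbb C$ be a continuous sesquilinear form which is coercive, i.e. there is a $\mu>0$ with $\operatorname{Re}\mathcal E(u,u)\ge\mu\|u\|_V^2$ for all $u\in V$, and let $\mathcal A\colon V\to V'$ be given by $\langle\mathcal Au,v\rangle_{V',V}=\mathcal E(u,v)$. Let $0<s<1$, and let $[H,V]_s\subset H$ and $[H,V']_s\subset V'$ be the complex interpolation spaces. Functions on $(0,\infty)$ are identified if they agree almost everywhere, and derivatives are weak derivatives with respect to test functions in $C_c^\infty((0,\infty))$. For $0<\theta<1$ and Hilbert spaces $Y\hookrightarrow X$ (densely and continuously) let $W_\theta(X,Y)$ be the space of all $u\in L^1_{\rm loc}((0,\infty);Y)$ with $u'\in L^1_{\rm loc}((0,\infty);X)$ such that $t^\theta u\in L^2((0,\infty);Y,\frac{dt}{t})$ and $t^\theta u'\in L^2((0,\infty);X,\frac{dt}{t})$.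 A function $u\in W_{1-s}(H,V)$ is called $s$-harmonic if $t^{1-2s}u'\in W_s(V',H)$ and $$-(t^{1-2s}u')'(t)+t^{1-2s}\mathcal Au(t)=0\quad\text{in }V'\text{ for a.e. }t\in(0,\infty).$$ Limits as $t\downarrow0$ are those of the continuous representatives: $u(0):=\lim_{t\downarrow0}u(t)$ is taken in $H$ and $\lim_{t\downarrow0}t^{1-2s}u'(t)$ is taken in $V'$. Then the following assertions hold. (a) (Dirichlet problem) For each $x\in[H,V]_s$ there exists a unique $s$-harmonic function $u$ such that $u(0)=x$. (b) (Neumann problem) For each $y\in[H,V']_s$ there exists a unique $s$-harmonic function $u$ such that $-\lim_{t\downarrow0}t^{1-2s}u'(t)=y$. -/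

import Mathlib

open MeasureTheory Set Filter
open scoped Topology ContDiff BoundedContinuousFunction

noncomputable section

namespace ExtensionProblem

/-! ### Complex interpolation -/

/-- The functions of the complex interpolation method for a compatible couple `X₀`, `X₁` of spaces
that are continuously embedded by `i₀`, `i₁` in the space `Z = X₀ + X₁`: bounded continuous
functions on the closed strip `0 ≤ Re z ≤ 1` with values in `X₀ + X₁`, holomorphic in the open
strip, whose restrictions to the boundary lines `Re z = 0` and `Re z = 1` are bounded continuous
functions with values in `X₀` and in `X₁` respectively. (In the applications below one of the two
spaces contains the other, so that `Z` is the larger one, embedded by the identity.) -/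
structure IsStripFunction {X₀ X₁ Z : Type*}
    [NormedAddCommGroup X₀] [NormedSpace ℂ X₀] [NormedAddCommGroup X₁] [NormedSpace ℂ X₁]
    [NormedAddCommGroup Z] [NormedSpace ℂ Z]
    (i₀ : X₀ →L[ℂ] Z) (i₁ : X₁ →L[ℂ] Z) (f : ℂ → Z) : Prop where
  continuousOn : ContinuousOn f {z : ℂ | 0 ≤ z.re ∧ z.re ≤ 1}
  bounded : ∃ C : ℝ, ∀ z : ℂ, 0 ≤ z.re → z.re ≤ 1 → ‖f z‖ ≤ C
  holomorphic : DifferentiableOn ℂ f {z : ℂ | 0 < z.re ∧ z.re < 1}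
  left : ∃ g : ℝ →ᵇ X₀, ∀ τ : ℝ, f ((τ : ℂ) * Complex.I) = i₀ (g τ)
  right : ∃ g : ℝ →ᵇ X₁, ∀ τ : ℝ, f (1 + (τ : ℂ) * Complex.I) = i₁ (g τ)

/-- The complex interpolation space `[X₀, X₁]_θ`, as a subset of `Z = X₀ + X₁`. -/
def complexInterp {X₀ X₁ Z : Type*}
    [NormedAddCommGroup X₀] [NormedSpace ℂ X₀] [NormedAddCommGroup X₁] [NormedSpace ℂ X₁]
    [NormedAddCommGroup Z] [NormedSpace ℂ Z]
    (i₀ : X₀ →L[ℂ] Z) (i₁ : X₁ →L[ℂ] Z) (θ : ℝ) : Set Z :=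
  {x | ∃ f : ℂ → Z, IsStripFunction i₀ i₁ f ∧ f (θ : ℂ) = x}

/-! ### Weak derivatives, weighted Sobolev spaces and traces on `(0, ∞)` -/

/-- `u, v ∈ L¹_loc((0, ∞); X)` and `v` is the weak derivative of `u`. -/
structure IsWeakDeriv {X : Type*} [NormedAddCommGroup X] [NormedSpace ℂ X]
    (u v : ℝ → X) : Prop where
  left_loc : LocallyIntegrableOn u (Ioi 0) volume
  right_loc : LocallyIntegrableOn v (Ioi 0) volume
  eq : ∀ φ : ℝ → ℂ, ContDiff ℝ ∞ φ → HasCompactSupport φ → tsupport φ ⊆ Ioi 0 →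
    -∫ t in Ioi (0 : ℝ), deriv φ t • u t = ∫ t in Ioi (0 : ℝ), φ t • v t

/-- The measure `dt / t` on `(0, ∞)`. -/
def starMeasure : Measure ℝ :=
  (volume.restrict (Ioi (0 : ℝ))).withDensity fun t => ENNReal.ofReal t⁻¹

/-- The function `t ↦ t ^ a • u t`. -/
def powMul {X : Type*} [NormedAddCommGroup X] [NormedSpace ℂ X]
    (a : ℝ) (u : ℝ → X) : ℝ → X :=
  fun t => ((t ^ a : ℝ) : ℂ) • u t

/-- Membership `u ∈ W_θ(X, Y)`, where `Y` is embedded in `X` by `j`: `u ∈ L¹_loc(Y)` has a weak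
derivative `u' ∈ L¹_loc(X)`, and `t ^ θ u ∈ L²(Y, dt / t)`, `t ^ θ u' ∈ L²(X, dt / t)`. -/
structure MemW {X Y : Type*} [NormedAddCommGroup X] [NormedSpace ℂ X]
    [NormedAddCommGroup Y] [NormedSpace ℂ Y]
    (j : Y →L[ℂ] X) (θ : ℝ) (u : ℝ → Y) : Prop where
  loc : LocallyIntegrableOn u (Ioi 0) volume
  memLp : MemLp (powMul θ u) 2 starMeasure
  deriv_memLp : ∃ u' : ℝ → X, IsWeakDeriv (fun t => j (u t)) u' ∧
    MemLp (powMul θ u') 2 starMeasure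

/-- `lim_{t ↓ 0} u t = x` in the norm of `X`, for a class `u` of functions on `(0, ∞)` modulo null
sets: the limit is the one of the continuous representative of `u`. -/
def HasTrace {X : Type*} [NormedAddCommGroup X] (u : ℝ → X) (x : X) : Prop :=
  ∃ v : ℝ → X, ContinuousOn v (Ioi 0) ∧ u =ᵐ[volume.restrict (Ioi 0)] v ∧
    Tendsto v (𝓝[>] 0) (𝓝 x)

/-! ### The Gelfand triple and `s`-harmonic functions -/

variable {H V : Type*} [NormedAddCommGroup H] [InnerProductSpace ℂ H]
  [NormedAddCommGroup V] [InnerProductSpace ℂ V]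

/-- The embedding `H → V'` of the Gelfand triple `V ↪ H ↪ V'`; here `V'` is the antidual
`V →L⋆[ℂ] ℂ` of `V`, and `h` is sent to the antilinear functional `v ↦ (h | v)_H`, where the
scalar product `(h | v)_H` is antilinear in `v` (that is, it is Mathlib's `inner ℂ v h`). -/
def toAntidual (ι : V →L[ℂ] H) : H →L[ℂ] (V →L⋆[ℂ] ℂ) :=
  ((innerSL ℂ).comp ι).flip

theorem toAntidual_apply (ι : V →L[ℂ] H) (h : H) (v : V) :
    toAntidual ι h v = inner ℂ (ι v) h := rfl

/-- `(E, s)`-harmonic functions. A continuous sesquilinear form `E` on `V`, linear in the first and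
antilinear in the second argument, is an element of `V →L[ℂ] (V →L⋆[ℂ] ℂ)`; as a map from `V` to
`V'` it is the operator `𝒜` with `⟨𝒜 u, v⟩ = E(u, v)`, so that `𝒜 (u t)` is `E (u t)`. -/
structure IsHarmonic (ι : V →L[ℂ] H) (E : V →L[ℂ] (V →L⋆[ℂ] ℂ)) (s : ℝ) (u : ℝ → V) : Prop where
  memW : MemW ι (1 - s) u
  equation : ∃ (u' : ℝ → H) (w' : ℝ → V →L⋆[ℂ] ℂ),
    IsWeakDeriv (fun t => ι (u t)) u' ∧
    MemW (toAntidual ι) s (powMul (1 - 2 * s) u') ∧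
    IsWeakDeriv (fun t => toAntidual ι (powMul (1 - 2 * s) u' t)) w' ∧
    ∀ᵐ t ∂volume.restrict (Ioi (0 : ℝ)),
      -w' t + powMul (1 - 2 * s) (fun τ => E (u τ)) t = 0

/-- `y ∈ V'` is the `s`-normal derivative of `u`: `-lim_{t ↓ 0} t ^ (1 - 2 s) u'(t) = y` in `V'`. -/
def HasNormalDeriv (ι : V →L[ℂ] H) (s : ℝ) (u : ℝ → V) (y : V →L⋆[ℂ] ℂ) : Prop :=
  ∃ u' : ℝ → H, IsWeakDeriv (fun t => ι (u t)) u' ∧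
    HasTrace (fun t => -toAntidual ι (powMul (1 - 2 * s) u' t)) y

end ExtensionProblem

end

/-!
The weighted spaces and the equation are treated variationally. Multiplication by `t ^ (1 - s)` turns
pairs `(u, u')` with `u ∈ W_{1-s}(H, V)` into elements of the Hilbert space `L²((0, ∞), dt / t; V × H)`,
and `u` is `s`-harmonic precisely if `∫ t ^ (1 - 2 s) (E (u, v) + (u' | v')) dt = 0` for enough test
functions `v`. This form is continuous and coercive in the weighted norm, because `E` is coercive on
`V` and the second summand is the square of the norm of `H`. The Lax–Milgram theorem on the closed
subspace of pairs `(u, u')` for which `u'` is the weak derivative of `u`, possibly with `u(0) = 0`,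
yields `exists_variational_solution`.

The data enter through one half of the identification of complex interpolation spaces with trace
spaces, `exists_isPrimitive_of_mem_complexInterp`: each `x ∈ [X, Y]_θ` is the value at `0` of some
`w ∈ W_{1-θ}(X, Y)`. Such a function is given by an inverse Mellin integral of a strip function `f` with
`f θ = x`, and Plancherel's theorem on the two boundary lines bounds it with values in `Y` and its
derivative with values in `X`.

* Dirichlet problem: `x` is the trace of some `Φ ∈ W_{1-s}(H, V)`, and `Φ` is corrected by the variational
  solution with zero trace.
* Neumann problem: `[H, V']_s = [V', H]_{1-s}`, so that `y` is the trace of some `w ∈ W_s(V', H)`. For `v`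
  in the form domain, `⟨y, v(0)⟩ = -∫ (⟨w', v⟩ + (w | v')) dt`, a continuous functional of `v`; the
  variational solution without boundary condition that represents it has normal derivative `y`.
* Uniqueness: if one of the initial data of a solution `u` vanishes, then
  `∫ t ^ (1 - 2 s) (E (u, u) + ‖u'‖²) dt = 0` (`integral_energy_eq_zero`), and so `u = 0`. The integration by
  parts is justified by regularizing `u` with the operators `(ι* ι + ε)⁻¹ ι*`. They map `H` to `V` and
  converge strongly to the identity on both spaces. No boundary term arises at `∞`, because
  `t ↦ (u(t) | t ^ (1 - 2 s) u'(t))` is integrable on `(0, ∞)`.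

Weak derivatives are used in the form of primitives that start at `0` (`IsPrimitive`). All derivatives
involved are integrable up to `0`, so that every solution has both initial data.
-/

namespace ExtensionProblem

/-! ### Primitives and weak derivatives on the half-line -/

section Primitive

variable {X Y Z : Type*} [NormedAddCommGroup X] [NormedAddCommGroup Y] [NormedAddCommGroup Z]

/-- Integration by parts for primitives: the square `(0, T] × (0, T]` is cut along its diagonal. -/
theorem integral_bilin_primitive_add [NormedSpace ℝ X] [NormedSpace ℝ Y] [NormedSpace ℝ Z]
    [CompleteSpace X] [CompleteSpace Y] [CompleteSpace Z]
    (B : X →L[ℝ] Y →L[ℝ] Z) {a : ℝ → X} {b : ℝ → Y} {T : ℝ} (hT : 0 ≤ T)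
    (ha : IntegrableOn a (Ioc 0 T)) (hb : IntegrableOn b (Ioc 0 T)) :
    (∫ t in Ioc 0 T, B (a t) (∫ τ in (0 : ℝ)..t, b τ)) +
      ∫ t in Ioc 0 T, B (∫ τ in (0 : ℝ)..t, a τ) (b t) =
    B (∫ t in (0 : ℝ)..T, a t) (∫ t in (0 : ℝ)..T, b t) := by
  set μ : Measure ℝ := volume.restrict (Ioc 0 T) with hμ
  have hF : Integrable (fun z : ℝ × ℝ => B (a z.1) (b z.2)) (μ.prod μ) :=
    ha.op_fst_snd (by fun_prop) ⟨‖B‖, B.le_opNorm₂⟩ hb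
  have hS : MeasurableSet {z : ℝ × ℝ | z.2 ≤ z.1} := measurableSet_le measurable_snd measurable_fst
  have h1 : ∫ z, {z : ℝ × ℝ | z.2 ≤ z.1}.indicator (fun z => B (a z.1) (b z.2)) z ∂(μ.prod μ) =
      ∫ t, B (a t) (∫ τ in (0 : ℝ)..t, b τ) ∂μ := by
    rw [integral_prod _ (hF.indicator hS)]
    refine setIntegral_congr_fun measurableSet_Ioc fun t ht => ?_
    have e : (fun τ => {z : ℝ × ℝ | z.2 ≤ z.1}.indicator (fun z => B (a z.1) (b z.2)) (t, τ)) =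
        (Iic t).indicator (fun τ => B (a t) (b τ)) := by
      ext τ; simp [indicator]
    simp only [e]
    rw [integral_indicator measurableSet_Iic, hμ, Measure.restrict_restrict measurableSet_Iic,
      ContinuousLinearMap.integral_comp_comm, intervalIntegral.integral_of_le ht.1.le]
    · congr 3
      ext x
      simp only [mem_inter_iff, mem_Iic, mem_Ioc]
      exact ⟨fun h => ⟨h.2.1, h.1⟩, fun h => ⟨h.2, h.1, h.2.trans ht.2⟩⟩
    · exact hb.mono_set inter_subset_right
  have h2 : ∫ z, {z : ℝ × ℝ | z.2 ≤ z.1}ᶜ.indicator (fun z => B (a z.1) (b z.2)) z ∂(μ.prod μ) =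
      ∫ t, B (∫ τ in (0 : ℝ)..t, a τ) (b t) ∂μ := by
    rw [integral_prod_symm _ (hF.indicator hS.compl)]
    refine setIntegral_congr_fun measurableSet_Ioc fun t ht => ?_
    have e : (fun τ => {z : ℝ × ℝ | z.2 ≤ z.1}ᶜ.indicator (fun z => B (a z.1) (b z.2)) (τ, t)) =
        (Iio t).indicator (fun τ => B.flip (b t) (a τ)) := by
      ext τ; simp [indicator]
    simp only [e]
    rw [integral_indicator measurableSet_Iio, hμ, Measure.restrict_restrict measurableSet_Iio,
      ContinuousLinearMap.integral_comp_comm, intervalIntegral.integral_of_le ht.1.le,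
      integral_Ioc_eq_integral_Ioo, ContinuousLinearMap.flip_apply]
    · congr 4
      ext x
      simp only [mem_inter_iff, mem_Iio, mem_Ioc, mem_Ioo]
      exact ⟨fun h => ⟨h.2.1, h.1⟩, fun h => ⟨h.2, h.1, h.2.le.trans ht.2⟩⟩
    · exact ha.mono_set inter_subset_right
  rw [← h1, ← h2, integral_indicator hS, integral_indicator hS.compl, integral_add_compl hS hF,
    integral_prod_bilin _ ha hb, intervalIntegral.integral_of_le hT,
    intervalIntegral.integral_of_le hT]

/-- `u(t) = x + ∫₀ᵗ v` for almost every `t > 0`, where `v` is integrable up to the point `0`. -/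
structure IsPrimitive [NormedSpace ℝ X] (x : X) (u v : ℝ → X) : Prop where
  integrableOn : ∀ R : ℝ, IntegrableOn v (Ioc 0 R)
  ae_eq : ∀ᵐ t ∂volume.restrict (Ioi (0 : ℝ)), u t = x + ∫ τ in (0 : ℝ)..t, v τ

theorem intervalIntegrable_of_Ioc {v : ℝ → X} (hv : ∀ R : ℝ, IntegrableOn v (Ioc 0 R))
    {a b : ℝ} (ha : 0 ≤ a) (hb : 0 ≤ b) : IntervalIntegrable v volume a b := by
  rw [intervalIntegrable_iff]
  refine (hv (max a b)).mono_set fun t ht => ?_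
  rw [uIoc, mem_Ioc] at ht
  exact ⟨(le_min ha hb).trans_lt ht.1, ht.2⟩

theorem continuousOn_primitive_Ici [NormedSpace ℝ X] {v : ℝ → X}
    (hv : ∀ R : ℝ, IntegrableOn v (Ioc 0 R)) :
    ContinuousOn (fun t => ∫ τ in (0 : ℝ)..t, v τ) (Ici 0) := by
  intro t ht
  have h := intervalIntegral.continuousOn_primitive_interval (a := 0) (b := t + 1) (f := v)
    (μ := volume) (by
      rw [uIcc_of_le (by linarith [mem_Ici.1 ht]), integrableOn_Icc_iff_integrableOn_Ioc]
      exact hv _)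
  rw [uIcc_of_le (by linarith [mem_Ici.1 ht])] at h
  refine (h t ⟨ht, by linarith⟩).mono_of_mem_nhdsWithin ?_
  have : Iic (t + 1) ∈ 𝓝 t := Iic_mem_nhds (by linarith)
  exact mem_of_superset (inter_mem self_mem_nhdsWithin (mem_nhdsWithin_of_mem_nhds this))
    fun y hy => ⟨hy.1, hy.2⟩

theorem locallyIntegrableOn_of_Ioc {v : ℝ → X} (hv : ∀ R : ℝ, IntegrableOn v (Ioc 0 R)) :
    LocallyIntegrableOn v (Ioi 0) := by
  intro t ht
  refine ⟨Ioc 0 (t + 1), ?_, hv _⟩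
  exact mem_nhdsWithin_of_mem_nhds (Ioc_mem_nhds ht (by linarith))

namespace IsPrimitive

variable [NormedSpace ℝ X] {x : X} {u v : ℝ → X}

theorem continuousOn (h : IsPrimitive x u v) :
    ContinuousOn (fun t => x + ∫ τ in (0 : ℝ)..t, v τ) (Ici 0) :=
  continuousOn_const.add (continuousOn_primitive_Ici h.integrableOn)

theorem hasTrace (h : IsPrimitive x u v) : HasTrace u x := by
  refine ⟨_, h.continuousOn.mono Ioi_subset_Ici_self, h.ae_eq, ?_⟩
  have := (h.continuousOn 0 self_mem_Ici).tendsto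
  simp only [intervalIntegral.integral_same, add_zero] at this
  exact this.mono_left (nhdsWithin_mono _ Ioi_subset_Ici_self)

theorem congr {u₂ v₂ : ℝ → X} (h : IsPrimitive x u v)
    (hu : u =ᵐ[volume.restrict (Ioi 0)] u₂) (hv : v =ᵐ[volume.restrict (Ioi 0)] v₂) :
    IsPrimitive x u₂ v₂ where
  integrableOn R := (h.integrableOn R).congr
    (ae_restrict_of_ae_restrict_of_subset Ioc_subset_Ioi_self hv)
  ae_eq := by
    filter_upwards [h.ae_eq, hu, ae_restrict_mem measurableSet_Ioi] with t ht e ht0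
    rw [← e, ht]
    congr 1
    rw [intervalIntegral.integral_of_le (mem_Ioi.1 ht0).le,
      intervalIntegral.integral_of_le (mem_Ioi.1 ht0).le]
    exact integral_congr_ae (ae_restrict_of_ae_restrict_of_subset Ioc_subset_Ioi_self hv)

theorem eq_of_hasTrace (h : IsPrimitive x u v) {y : X} (hy : HasTrace u y) : y = x := by
  obtain ⟨w, hw, hu, hlim⟩ := hy
  obtain ⟨w', hw', hu', hlim'⟩ := h.hasTrace
  have : EqOn w w' (Ioi 0) := Measure.eqOn_open_of_ae_eq (hu.symm.trans hu') isOpen_Ioi hw hw'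
  exact tendsto_nhds_unique (hlim.congr' (this.eventuallyEq_of_mem self_mem_nhdsWithin)) hlim'

theorem locallyIntegrableOn (h : IsPrimitive x u v) : LocallyIntegrableOn u (Ioi 0) := by
  have h1 := (h.continuousOn.mono Ioi_subset_Ici_self).locallyIntegrableOn (μ := volume)
    measurableSet_Ioi
  intro t ht
  obtain ⟨s, hs, hi⟩ := h1 t ht
  refine ⟨s ∩ Ioi 0, inter_mem hs self_mem_nhdsWithin, ?_⟩
  refine (hi.mono_set inter_subset_left).congr ?_
  have := ae_restrict_of_ae_restrict_of_subset (inter_subset_right (s := s)) h.ae_eq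
  filter_upwards [this] with t ht using ht.symm

theorem comp_clm (h : IsPrimitive x u v) [NormedSpace ℝ Y] [CompleteSpace X] [CompleteSpace Y]
    (L : X →L[ℝ] Y) :
    IsPrimitive (L x) (fun t => L (u t)) (fun t => L (v t)) where
  integrableOn R := L.integrable_comp (h.integrableOn R)
  ae_eq := by
    filter_upwards [h.ae_eq, ae_restrict_mem measurableSet_Ioi] with t ht ht0
    rw [ht, map_add, L.intervalIntegral_comp_comm
      (intervalIntegrable_of_Ioc h.integrableOn le_rfl (mem_Ioi.1 ht0).le)]

theorem sub (h : IsPrimitive x u v) {y : X} {u' v' : ℝ → X} (h' : IsPrimitive y u' v') :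
    IsPrimitive (x - y) (fun t => u t - u' t) (fun t => v t - v' t) where
  integrableOn R := (h.integrableOn R).sub (h'.integrableOn R)
  ae_eq := by
    filter_upwards [h.ae_eq, h'.ae_eq, ae_restrict_mem measurableSet_Ioi] with t ht ht' ht0
    rw [ht, ht', intervalIntegral.integral_sub
      (intervalIntegrable_of_Ioc h.integrableOn le_rfl (mem_Ioi.1 ht0).le)
      (intervalIntegrable_of_Ioc h'.integrableOn le_rfl (mem_Ioi.1 ht0).le)]
    abel

end IsPrimitive

end Primitive

section WeakDeriv

variable {X : Type*} [NormedAddCommGroup X] [NormedSpace ℂ X]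

/-- Integration by parts against a test function that need not vanish at `0`. -/
theorem IsPrimitive.integral_deriv_smul [CompleteSpace X] {x : X} {u v : ℝ → X}
    (h : IsPrimitive x u v) {φ : ℝ → ℂ} (hφ : ContDiff ℝ ∞ φ) (hc : HasCompactSupport φ) :
    ∫ t in Ioi (0 : ℝ), deriv φ t • u t = -(φ 0 • x) - ∫ t in Ioi (0 : ℝ), φ t • v t := by
  obtain ⟨R, hR0, hR⟩ : ∃ R > 0, tsupport φ ⊆ Iic R := by
    obtain ⟨R, hR⟩ := hc.isCompact.bddAbove
    exact ⟨max R 1, by simp, fun t ht => (hR ht).trans (le_max_left _ _)⟩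
  have hφ0 : ∀ t, R < t → φ t = 0 := fun t ht => by
    by_contra hne
    exact absurd (hR (subset_tsupport _ hne)) (not_le.2 ht)
  have hdφ0 : ∀ t, R < t → deriv φ t = 0 := fun t ht => by
    by_contra hne
    exact absurd (hR (tsupport_deriv_subset (subset_tsupport _ hne))) (not_le.2 ht)
  have hφR : φ R = 0 := by
    have h1 : Tendsto φ (𝓝[>] R) (𝓝 (φ R)) := hφ.continuous.continuousAt.mono_left nhdsWithin_le_nhds
    refine tendsto_nhds_unique h1 (tendsto_const_nhds.congr' ?_)
    filter_upwards [self_mem_nhdsWithin] with t ht using (hφ0 t ht).symm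
  have hdφ : Continuous (deriv φ) := hφ.continuous_deriv (by simp)
  have hprim : ∀ t, ∫ τ in (0 : ℝ)..t, deriv φ τ = φ t - φ 0 := fun t =>
    intervalIntegral.integral_deriv_eq_sub (fun y _ => (hφ.differentiable (by simp)).differentiableAt)
      (hdφ.intervalIntegrable _ _)
  have hcut : ∀ {f : ℝ → X}, (∀ t, R < t → f t = 0) →
      ∫ t in Ioi (0 : ℝ), f t = ∫ t in Ioc 0 R, f t := fun {f} hf => by
    refine setIntegral_eq_of_subset_of_forall_sdiff_eq_zero measurableSet_Ioi Ioc_subset_Ioi_self ?_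
    intro t ht
    refine hf t ?_
    by_contra hlt
    exact ht.2 ⟨ht.1, not_lt.1 hlt⟩
  have key := integral_bilin_primitive_add (ContinuousLinearMap.lsmul ℝ ℂ : ℂ →L[ℝ] X →L[ℝ] X)
    hR0.le (hdφ.integrableOn_Ioc (μ := volume)) (h.integrableOn R)
  simp only [hprim, ContinuousLinearMap.lsmul_apply, hφR, zero_sub] at key
  have hVint : IntegrableOn (fun t => ∫ τ in (0 : ℝ)..t, v τ) (Icc 0 R) :=
    ((continuousOn_primitive_Ici h.integrableOn).mono Icc_subset_Ici_self).integrableOn_Icc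
  have i1 : IntegrableOn (fun t => deriv φ t • ∫ τ in (0 : ℝ)..t, v τ) (Ioc 0 R) := by
    refine IntegrableOn.mono_set ?_ Ioc_subset_Icc_self
    exact hVint.continuousOn_smul hdφ.continuousOn isCompact_Icc
  have i2 : IntegrableOn (fun t => φ t • v t) (Ioc 0 R) := by
    have := (integrableOn_Icc_iff_integrableOn_Ioc (by simp)).2 (h.integrableOn R)
    exact (this.continuousOn_smul hφ.continuous.continuousOn isCompact_Icc).mono_set
      Ioc_subset_Icc_self
  have i3 : IntegrableOn (fun t => deriv φ t • x) (Ioc 0 R) :=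
    (hdφ.smul continuous_const).integrableOn_Ioc
  have i4 : IntegrableOn (fun t => φ 0 • v t) (Ioc 0 R) := (h.integrableOn R).smul (φ 0)
  have e1 : ∫ t in Ioi (0 : ℝ), deriv φ t • u t =
      ∫ t in Ioi (0 : ℝ), deriv φ t • (x + ∫ τ in (0 : ℝ)..t, v τ) := by
    refine integral_congr_ae ?_
    filter_upwards [h.ae_eq] with t ht
    rw [ht]
  have e3 : ∫ t in Ioc 0 R, deriv φ t • x = -(φ 0 • x) := by
    rw [integral_smul_const, ← intervalIntegral.integral_of_le hR0.le, hprim, hφR, zero_sub,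
      neg_smul]
  simp only [sub_smul] at key
  rw [integral_sub i2 i4, integral_smul, intervalIntegral.integral_of_le hR0.le, neg_smul] at key
  rw [e1, hcut (fun t ht => by rw [hdφ0 t ht, zero_smul]),
    hcut (fun t ht => by rw [hφ0 t ht, zero_smul])]
  simp only [smul_add]
  rw [integral_add i3 i1, e3, sub_eq_add_neg]
  congr 1
  rw [← add_sub_assoc, sub_eq_iff_eq_add, neg_add_cancel] at key
  exact eq_neg_of_add_eq_zero_left key

theorem zero_of_tsupport_subset {φ : ℝ → ℂ} (hs : tsupport φ ⊆ Ioi 0) {t : ℝ} (ht : t ≤ 0) :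
    φ t = 0 := by
  by_contra hne
  exact absurd (hs (subset_tsupport _ hne)) (not_lt.2 ht)

theorem IsPrimitive.isWeakDeriv [CompleteSpace X] {x : X} {u v : ℝ → X}
    (h : IsPrimitive x u v) : IsWeakDeriv u v where
  left_loc := h.locallyIntegrableOn
  right_loc := locallyIntegrableOn_of_Ioc h.integrableOn
  eq φ hφ hc hs := by
    rw [h.integral_deriv_smul hφ hc, zero_of_tsupport_subset hs le_rfl]
    simp

theorem IsWeakDeriv.congr {u v u' v' : ℝ → X} (h : IsWeakDeriv u v)
    (hu : u =ᵐ[volume.restrict (Ioi 0)] u') (hv : v =ᵐ[volume.restrict (Ioi 0)] v') :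
    IsWeakDeriv u' v' := by
  have aux : ∀ {f g : ℝ → X}, f =ᵐ[volume.restrict (Ioi 0)] g →
      LocallyIntegrableOn f (Ioi 0) volume → LocallyIntegrableOn g (Ioi 0) volume := by
    intro f g hfg hf t ht
    obtain ⟨s, hs, hi⟩ := hf t ht
    refine ⟨s ∩ Ioi 0, inter_mem hs self_mem_nhdsWithin, ?_⟩
    exact (hi.mono_set inter_subset_left).congr
      (ae_restrict_of_ae_restrict_of_subset inter_subset_right hfg)
  refine ⟨aux hu h.left_loc, aux hv h.right_loc, fun φ hφ hc hs => ?_⟩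
  have e1 : ∫ t in Ioi (0 : ℝ), deriv φ t • u' t = ∫ t in Ioi (0 : ℝ), deriv φ t • u t :=
    integral_congr_ae (by filter_upwards [hu] with t ht; rw [ht])
  have e2 : ∫ t in Ioi (0 : ℝ), φ t • v' t = ∫ t in Ioi (0 : ℝ), φ t • v t :=
    integral_congr_ae (by filter_upwards [hv] with t ht; rw [ht])
  rw [e1, e2, h.eq φ hφ hc hs]

theorem integrableOn_smul_of_tsupport {φ : ℝ → ℂ} (hφ : Continuous φ) (hc : HasCompactSupport φ)
    (hs : tsupport φ ⊆ Ioi 0) {u : ℝ → X} (hu : LocallyIntegrableOn u (Ioi 0)) :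
    IntegrableOn (fun t => φ t • u t) (Ioi 0) := by
  have h1 : IntegrableOn (fun t => φ t • u t) (tsupport φ) :=
    (hu.integrableOn_compact_subset hs hc.isCompact).continuousOn_smul hφ.continuousOn hc.isCompact
  refine h1.of_forall_sdiff_eq_zero measurableSet_Ioi fun t ht => ?_
  rw [image_eq_zero_of_notMem_tsupport ht.2, zero_smul]

theorem tsupport_ofReal (g : ℝ → ℝ) : tsupport (fun t => (g t : ℂ)) = tsupport g := by
  unfold tsupport; congr 1; ext t; simp

theorem integral_ofReal_smul_Ioi {g : ℝ → ℝ} (hs : tsupport g ⊆ Ioi 0) (u : ℝ → X) :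
    ∫ t in Ioi (0 : ℝ), (g t : ℂ) • u t = ∫ t, g t • u t := by
  rw [setIntegral_eq_integral_of_forall_compl_eq_zero]
  · simp
  · intro t ht
    rw [image_eq_zero_of_notMem_tsupport fun h => ht (hs h)]
    simp

/-- Weak derivatives are unique. Real test functions are regarded as complex ones here. -/
theorem IsWeakDeriv.ae_unique [CompleteSpace X] {u v v' : ℝ → X} (h : IsWeakDeriv u v)
    (h' : IsWeakDeriv u v') : v =ᵐ[volume.restrict (Ioi 0)] v' := by
  have key : ∀ᵐ t, t ∈ Ioi (0 : ℝ) → (v - v') t = 0 := by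
    refine isOpen_Ioi.ae_eq_zero_of_integral_contDiff_smul_eq_zero
      (h.right_loc.sub h'.right_loc) fun g hg hgc hgs => ?_
    have hg' : ContDiff ℝ ∞ (fun t => (g t : ℂ)) := Complex.ofRealCLM.contDiff.comp hg
    have hgc' : HasCompactSupport (fun t => (g t : ℂ)) := hgc.comp_left Complex.ofReal_zero
    have hgs' : tsupport (fun t => (g t : ℂ)) ⊆ Ioi 0 := tsupport_ofReal g ▸ hgs
    have e := (h.eq _ hg' hgc' hgs').symm.trans (h'.eq _ hg' hgc' hgs')
    rw [← integral_ofReal_smul_Ioi hgs]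
    simp only [Pi.sub_apply, smul_sub]
    rw [integral_sub (integrableOn_smul_of_tsupport hg'.continuous hgc' hgs' h.right_loc)
      (integrableOn_smul_of_tsupport hg'.continuous hgc' hgs' h'.right_loc), e, sub_self]
  filter_upwards [(ae_restrict_iff' measurableSet_Ioi).2 key] with t ht
  exact sub_eq_zero.1 ht

/-- A test function with vanishing integral is the derivative of a test function. -/
theorem exists_primitive_testFunction {h : ℝ → ℝ} (hh : ContDiff ℝ ∞ h) (hc : HasCompactSupport h)
    (hs : tsupport h ⊆ Ioi 0) (h0 : ∫ t, h t = 0) :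
    ∃ φ : ℝ → ℝ, ContDiff ℝ ∞ φ ∧ HasCompactSupport φ ∧ tsupport φ ⊆ Ioi 0 ∧ deriv φ = h := by
  obtain ⟨a, ha, b, hab⟩ : ∃ a > 0, ∃ b, tsupport h ⊆ Ioc a b := by
    obtain ⟨b, hb⟩ := hc.isCompact.bddAbove
    rcases (tsupport h).eq_empty_or_nonempty with he | hne
    · exact ⟨1, one_pos, 1, by simp [he]⟩
    · have hm := hc.isCompact.sInf_mem hne
      refine ⟨sInf (tsupport h) / 2, half_pos (hs hm), b, fun t ht => ⟨?_, hb ht⟩⟩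
      have h1 := csInf_le hc.isCompact.bddBelow ht
      have h2 : 0 < sInf (tsupport h) := hs hm
      linarith
  have hz : ∀ t, t ∉ Ioc a b → h t = 0 := fun t ht =>
    image_eq_zero_of_notMem_tsupport fun h' => ht (hab h')
  set φ : ℝ → ℝ := fun t => ∫ τ in (0 : ℝ)..t, h τ with hφ
  have hd : deriv φ = h := by
    ext t
    exact Continuous.deriv_integral h hh.continuous 0 t
  have hφz : ∀ t, t ∉ Icc a b → φ t = 0 := by
    intro t ht
    rcases lt_or_ge t a with hta | hta
    · refine intervalIntegral.integral_zero_ae (Eventually.of_forall fun τ hτ => hz τ fun h' => ?_)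
      have h1 : τ ≤ max 0 t := hτ.2
      have h2 : max 0 t < a := max_lt ha hta
      exact absurd h'.1 (by linarith)
    · have htb : b < t := not_le.1 fun h' => ht ⟨hta, h'⟩
      rw [hφ]
      dsimp only
      rw [intervalIntegral.integral_eq_integral_of_support_subset, h0]
      exact (subset_tsupport h).trans (hab.trans (Ioc_subset_Ioc ha.le htb.le))
  have hts : tsupport φ ⊆ Icc a b :=
    closure_minimal (fun t ht => by_contra fun h' => ht (hφz t h')) isClosed_Icc
  refine ⟨φ, ?_, ?_, hts.trans fun t ht => ha.trans_le ht.1, hd⟩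
  · rw [contDiff_infty_iff_deriv, hd]
    exact ⟨fun t => (hh.continuous.integral_hasStrictDerivAt 0 t).hasDerivAt.differentiableAt, hh⟩
  · exact HasCompactSupport.of_support_subset_isCompact isCompact_Icc
      ((subset_tsupport φ).trans hts)

/-- A function is the primitive of its weak derivative (lemma of du Bois-Reymond). -/
theorem IsWeakDeriv.exists_isPrimitive [CompleteSpace X] {u v : ℝ → X} (h : IsWeakDeriv u v)
    (hv : ∀ R : ℝ, IntegrableOn v (Ioc 0 R)) : ∃ x, IsPrimitive x u v := by
  have hV : IsPrimitive 0 (fun t => ∫ τ in (0 : ℝ)..t, v τ) v := ⟨hv, by simp⟩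
  set z : ℝ → X := fun t => u t - ∫ τ in (0 : ℝ)..t, v τ with hz
  have hzl : LocallyIntegrableOn z (Ioi 0) := h.left_loc.sub hV.locallyIntegrableOn
  obtain ⟨ρ, hρ, hρc, hρs, hρ1⟩ : ∃ ρ : ℝ → ℝ, ContDiff ℝ ∞ ρ ∧ HasCompactSupport ρ ∧
      tsupport ρ ⊆ Ioi 0 ∧ ∫ t, ρ t = 1 := by
    let f : ContDiffBump (1 : ℝ) := ⟨1 / 4, 1 / 2, by norm_num, by norm_num⟩
    refine ⟨f.normed volume, f.contDiff_normed, f.hasCompactSupport_normed, ?_, f.integral_normed⟩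
    rw [f.tsupport_normed_eq, Real.closedBall_eq_Icc]
    intro t ht
    have h1 : (1 : ℝ) - 1 / 2 ≤ t := ht.1
    exact mem_Ioi.2 (by linarith)
  have hint : ∀ {g : ℝ → ℝ}, ContDiff ℝ ∞ g → HasCompactSupport g → tsupport g ⊆ Ioi 0 →
      ∀ {w : ℝ → X}, LocallyIntegrableOn w (Ioi 0) → Integrable (fun t => g t • w t) := by
    intro g hg hgc hgs w hw
    have h1 := integrableOn_smul_of_tsupport (Complex.continuous_ofReal.comp hg.continuous)
      (hgc.comp_left Complex.ofReal_zero) ((tsupport_ofReal g).symm ▸ hgs) hw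
    rw [integrableOn_iff_integrable_of_support_subset] at h1
    · simpa using h1
    · intro t ht
      refine hgs (subset_tsupport _ fun h0 => ht ?_)
      simp [h0]
  have hzero : ∀ {φ : ℝ → ℝ}, ContDiff ℝ ∞ φ → HasCompactSupport φ → tsupport φ ⊆ Ioi 0 →
      ∫ t, deriv φ t • z t = 0 := by
    intro φ hφ hφc hφs
    have hφ' : ContDiff ℝ ∞ (fun t => (φ t : ℂ)) := Complex.ofRealCLM.contDiff.comp hφ
    have hφc' : HasCompactSupport (fun t => (φ t : ℂ)) := hφc.comp_left Complex.ofReal_zero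
    have hφs' : tsupport (fun t => (φ t : ℂ)) ⊆ Ioi 0 := tsupport_ofReal φ ▸ hφs
    have hd : deriv (fun t => (φ t : ℂ)) = fun t => ((deriv φ t : ℝ) : ℂ) := by
      ext t
      exact ((hφ.differentiable (by simp)).differentiableAt.hasDerivAt.ofReal_comp).deriv
    have e := (h.eq _ hφ' hφc' hφs').trans (hV.isWeakDeriv.eq _ hφ' hφc' hφs').symm
    have hds : tsupport (deriv φ) ⊆ Ioi 0 := tsupport_deriv_subset.trans hφs
    rw [hd, integral_ofReal_smul_Ioi hds, integral_ofReal_smul_Ioi hds, neg_inj] at e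
    have hdsm : ContDiff ℝ ∞ (deriv φ) := (contDiff_infty_iff_deriv.1 hφ).2
    simp only [hz, smul_sub]
    rw [integral_sub (hint hdsm hφc.deriv hds h.left_loc)
      (hint hdsm hφc.deriv hds hV.locallyIntegrableOn), e, sub_self]
  -- `z` is orthogonal to all derivatives of test functions, hence to all test functions with
  -- vanishing integral, and so it equals the constant `∫ ρ z`
  refine ⟨∫ t, ρ t • z t, hv, ?_⟩
  set x : X := ∫ t, ρ t • z t with hx
  have key : ∀ᵐ t, t ∈ Ioi (0 : ℝ) → z t - x = 0 := by
    have hxl : LocallyIntegrableOn (fun _ : ℝ => x) (Ioi 0) := locallyIntegrableOn_const x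
    refine isOpen_Ioi.ae_eq_zero_of_integral_contDiff_smul_eq_zero
      (hzl.sub hxl) fun g hg hgc hgs => ?_
    have hgρ : tsupport (fun t => g t - (∫ τ, g τ) * ρ t) ⊆ Ioi 0 := by
      refine (tsupport_sub _ _).trans (union_subset hgs ?_)
      exact (tsupport_mul_subset_right).trans hρs
    have hgi : Integrable g := hg.continuous.integrable_of_hasCompactSupport hgc
    have hρi : Integrable ρ := hρ.continuous.integrable_of_hasCompactSupport hρc
    obtain ⟨φ, hφ, hφc, hφs, hφd⟩ := exists_primitive_testFunction
      (h := fun t => g t - (∫ τ, g τ) * ρ t) (hg.sub (contDiff_const.mul hρ))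
      (hgc.sub hρc.mul_left) hgρ
      (by rw [integral_sub hgi (hρi.const_mul _), integral_const_mul, hρ1, mul_one, sub_self])
    have e := hzero hφ hφc hφs
    rw [hφd] at e
    simp only [sub_smul, mul_smul] at e
    have i2 : Integrable (fun t => (∫ τ, g τ) • ρ t • z t) := (hint hρ hρc hρs hzl).smul _
    rw [integral_sub (hint hg hgc hgs hzl) i2, integral_smul,
      ← hx] at e
    simp only [smul_sub]
    rw [integral_sub (hint hg hgc hgs hzl) (hint hg hgc hgs hxl), integral_smul_const, e]
  filter_upwards [(ae_restrict_iff' measurableSet_Ioi).2 key] with t ht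
  rw [← sub_eq_zero.1 ht, hz]
  simp

theorem exists_testFunction_zero_eq_one :
    ∃ φ : ℝ → ℂ, ContDiff ℝ ∞ φ ∧ HasCompactSupport φ ∧ φ 0 = 1 := by
  let f : ContDiffBump (0 : ℝ) := ⟨1, 2, one_pos, one_lt_two⟩
  refine ⟨fun t => (f t : ℂ), Complex.ofRealCLM.contDiff.comp f.contDiff,
    f.hasCompactSupport.comp_left Complex.ofReal_zero, ?_⟩
  simp [f.one_of_mem_closedBall (Metric.mem_closedBall_self zero_le_one)]

end WeakDeriv

/-! ### The measure `dt / t` -/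

section Star

theorem measurable_ofReal_inv : Measurable fun t : ℝ => ENNReal.ofReal t⁻¹ :=
  ENNReal.measurable_ofReal.comp measurable_inv

theorem ae_starMeasure_iff {p : ℝ → Prop} :
    (∀ᵐ t ∂starMeasure, p t) ↔ ∀ᵐ t ∂volume.restrict (Ioi (0 : ℝ)), p t := by
  rw [starMeasure, ae_withDensity_iff measurable_ofReal_inv]
  refine eventually_congr ?_
  filter_upwards [ae_restrict_mem measurableSet_Ioi] with t ht
  have : ENNReal.ofReal t⁻¹ ≠ 0 := (ENNReal.ofReal_pos.2 (inv_pos.2 ht)).ne'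
  simp [this]

theorem ae_starMeasure_eq : ae starMeasure = ae (volume.restrict (Ioi (0 : ℝ))) :=
  Filter.ext fun _ => ae_starMeasure_iff

theorem starMeasure_absolutelyContinuous : starMeasure ≪ volume.restrict (Ioi (0 : ℝ)) :=
  withDensity_absolutelyContinuous _ _

theorem absolutelyContinuous_starMeasure : volume.restrict (Ioi (0 : ℝ)) ≪ starMeasure :=
  Measure.ae_le_iff_absolutelyContinuous.1 ae_starMeasure_eq.ge

/-- The substitution `t = exp (2 π ξ)` turns `dt / t` into a multiple of Lebesgue measure. -/
theorem map_exp_volume :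
    Measure.map (fun ξ : ℝ => Real.exp (2 * Real.pi * ξ))
      (ENNReal.ofReal (2 * Real.pi) • (volume : Measure ℝ)) = starMeasure := by
  have hpi : 0 < 2 * Real.pi := by positivity
  have hm : Measurable fun ξ : ℝ => Real.exp (2 * Real.pi * ξ) := by fun_prop
  have hinj : Function.Injective fun ξ : ℝ => Real.exp (2 * Real.pi * ξ) := fun a b h => by
    simpa [hpi.ne', Real.pi_ne_zero] using Real.exp_injective h
  have hd : ∀ ξ ∈ (univ : Set ℝ), HasDerivWithinAt (fun ξ : ℝ => Real.exp (2 * Real.pi * ξ))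
      (Real.exp (2 * Real.pi * ξ) * (2 * Real.pi)) univ ξ := fun ξ _ => by
    have := ((hasDerivAt_id ξ).const_mul (2 * Real.pi)).exp
    simp only [id, mul_one] at this
    exact this.hasDerivWithinAt
  have himage : (fun ξ : ℝ => Real.exp (2 * Real.pi * ξ)) '' univ = Ioi 0 := by
    ext t
    simp only [image_univ, mem_range, mem_Ioi]
    constructor
    · rintro ⟨ξ, rfl⟩
      exact Real.exp_pos _
    · intro ht
      refine ⟨Real.log t / (2 * Real.pi), ?_⟩
      rw [mul_div_cancel₀ _ hpi.ne', Real.exp_log ht]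
  ext S hS
  have key := lintegral_image_eq_lintegral_abs_deriv_mul MeasurableSet.univ hd hinj.injOn
    (S.indicator fun t => ENNReal.ofReal t⁻¹)
  rw [himage, Measure.restrict_univ, lintegral_indicator hS,
    Measure.restrict_restrict hS] at key
  rw [Measure.map_apply hm hS, starMeasure, withDensity_apply _ hS,
    Measure.restrict_restrict hS, key, Measure.smul_apply, smul_eq_mul,
    ← lintegral_indicator_const (hm hS)]
  refine lintegral_congr fun ξ => ?_
  by_cases hξ : Real.exp (2 * Real.pi * ξ) ∈ S
  · rw [indicator_of_mem (by exact hξ), indicator_of_mem (by exact hξ),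
      abs_of_pos (by positivity), ← ENNReal.ofReal_mul (by positivity)]
    congr 1
    field_simp
  · rw [indicator_of_notMem (by exact hξ), indicator_of_notMem (by exact hξ), mul_zero]

variable {X Y Z : Type*} [NormedAddCommGroup X] [NormedSpace ℂ X]
  [NormedAddCommGroup Y] [NormedSpace ℂ Y] [NormedAddCommGroup Z] [NormedSpace ℂ Z]

theorem powMul_congr {a : ℝ} {f g : ℝ → X} (h : f =ᵐ[volume.restrict (Ioi 0)] g) :
    powMul a f =ᵐ[volume.restrict (Ioi 0)] powMul a g := by
  filter_upwards [h] with t ht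
  simp [powMul, ht]

theorem toReal_ofReal_inv_ae :
    (fun t : ℝ => (ENNReal.ofReal t⁻¹).toReal) =ᵐ[volume.restrict (Ioi 0)] fun t => t⁻¹ := by
  filter_upwards [ae_restrict_mem measurableSet_Ioi] with t ht
  exact ENNReal.toReal_ofReal (inv_nonneg.2 (le_of_lt ht))

theorem integral_starMeasure {E : Type*} [NormedAddCommGroup E] [NormedSpace ℝ E] (f : ℝ → E) :
    ∫ t, f t ∂starMeasure = ∫ t in Ioi (0 : ℝ), t⁻¹ • f t := by
  rw [starMeasure, integral_withDensity_eq_integral_toReal_smul measurable_ofReal_inv (by simp)]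
  refine integral_congr_ae ?_
  filter_upwards [toReal_ofReal_inv_ae] with t ht
  rw [ht]

theorem integrable_starMeasure_iff {E : Type*} [NormedAddCommGroup E] [NormedSpace ℝ E]
    {f : ℝ → E} :
    Integrable f starMeasure ↔ IntegrableOn (fun t => t⁻¹ • f t) (Ioi 0) := by
  rw [starMeasure, integrable_withDensity_iff_integrable_smul' measurable_ofReal_inv (by simp)]
  refine integrable_congr ?_
  filter_upwards [toReal_ofReal_inv_ae] with t ht
  rw [ht]

theorem powMul_powMul (a b : ℝ) (f : ℝ → X) {t : ℝ} (ht : 0 < t) :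
    powMul a (powMul b f) t = powMul (a + b) f t := by
  simp only [powMul, smul_smul, Real.rpow_add ht, Complex.ofReal_mul]

theorem powMul_eq_smul (a : ℝ) (f : ℝ → X) (t : ℝ) : powMul a f t = (t ^ a : ℝ) • f t :=
  Complex.coe_smul _ _

theorem norm_powMul (a : ℝ) (f : ℝ → X) {t : ℝ} (ht : 0 < t) :
    ‖powMul a f t‖ = t ^ a * ‖f t‖ := by
  rw [powMul_eq_smul, norm_smul, Real.norm_of_nonneg (Real.rpow_nonneg ht.le _)]

theorem inv_smul_bilin_powMul (B : X →L[ℝ] Y →L[ℝ] Z) (a : ℝ) (f : ℝ → X) (g : ℝ → Y) {t : ℝ}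
    (ht : 0 < t) : t⁻¹ • B (powMul a f t) (powMul (1 - a) g t) = B (f t) (g t) := by
  rw [powMul_eq_smul, powMul_eq_smul, map_smul, map_smul, smul_apply,
    smul_smul, smul_smul, Real.rpow_sub ht, Real.rpow_one]
  have : t ^ a ≠ 0 := (Real.rpow_pos_of_pos ht a).ne'
  rw [show t⁻¹ * (t / t ^ a) * t ^ a = 1 by field_simp, one_smul]

/-- Hölder's inequality for the weighted `L²` spaces. -/
theorem integrableOn_bilin (B : X →L[ℝ] Y →L[ℝ] Z) {a : ℝ} {f : ℝ → X} {g : ℝ → Y}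
    (hf : MemLp (powMul a f) 2 starMeasure) (hg : MemLp (powMul (1 - a) g) 2 starMeasure) :
    IntegrableOn (fun t => B (f t) (g t)) (Ioi 0) := by
  have h := memLp_one_iff_integrable.1 (B.memLp_of_bilin 1 hf hg)
  rw [integrable_starMeasure_iff] at h
  refine h.congr ?_
  filter_upwards [ae_restrict_mem measurableSet_Ioi] with t ht
  exact inv_smul_bilin_powMul B a f g ht

theorem integrableOn_norm_mul_norm {a : ℝ} {f : ℝ → X} {g : ℝ → Y}
    (hf : MemLp (powMul a f) 2 starMeasure) (hg : MemLp (powMul (1 - a) g) 2 starMeasure) :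
    IntegrableOn (fun t => ‖f t‖ * ‖g t‖) (Ioi 0) := by
  have h := integrable_starMeasure_iff.1 (hf.norm.integrable_mul hg.norm)
  refine h.congr ?_
  filter_upwards [ae_restrict_mem measurableSet_Ioi] with t ht
  have ht0 : 0 < t := ht
  have hta : 0 < t ^ a := Real.rpow_pos_of_pos ht0 a
  simp only [Pi.mul_apply, norm_powMul _ _ ht0, Real.rpow_sub ht0, Real.rpow_one, smul_eq_mul]
  field_simp

theorem integral_bilin_starMeasure (B : X →L[ℝ] Y →L[ℝ] Z) (a : ℝ) (f : ℝ → X) (g : ℝ → Y) :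
    ∫ t, B (powMul a f t) (powMul (1 - a) g t) ∂starMeasure =
      ∫ t in Ioi (0 : ℝ), B (f t) (g t) := by
  rw [integral_starMeasure]
  exact setIntegral_congr_fun measurableSet_Ioi fun t ht => inv_smul_bilin_powMul B a f g ht

theorem aestronglyMeasurable_powMul (a : ℝ) {f : ℝ → X} {μ : Measure ℝ}
    (hf : AEStronglyMeasurable f μ) : AEStronglyMeasurable (powMul a f) μ := by
  refine AEStronglyMeasurable.smul ?_ hf
  exact (Complex.measurable_ofReal.comp (measurable_id.pow_const a)).aestronglyMeasurable

theorem memLp_powMul_of_bounded {a : ℝ} (ha : 0 < a) {f : ℝ → X}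
    (hf : AEStronglyMeasurable f (volume.restrict (Ioi 0))) {C R : ℝ} (hC : ∀ t, ‖f t‖ ≤ C)
    (hR : ∀ t, R < t → f t = 0) : MemLp (powMul a f) 2 starMeasure := by
  have hm : AEStronglyMeasurable (powMul a f) (volume.restrict (Ioi 0)) :=
    aestronglyMeasurable_powMul a hf
  rw [memLp_two_iff_integrable_sq_norm (hm.mono_ac starMeasure_absolutelyContinuous),
    integrable_starMeasure_iff]
  have hi : IntegrableOn (fun t : ℝ => C ^ 2 * t ^ (2 * a - 1)) (Ioc 0 (max R 0)) :=
    ((intervalIntegral.intervalIntegrable_rpow' (by linarith)).const_mul _).1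
  have hi' : IntegrableOn (fun t => t⁻¹ • ‖powMul a f t‖ ^ 2) (Ioc 0 (max R 0)) := by
    refine Integrable.mono' hi ?_ ?_
    · refine AEStronglyMeasurable.smul measurable_inv.aestronglyMeasurable ?_
      exact ((hm.mono_measure (Measure.restrict_mono Ioc_subset_Ioi_self le_rfl)).norm.pow 2)
    · filter_upwards [ae_restrict_mem measurableSet_Ioc] with t ht
      have ht0 : 0 < t := ht.1
      rw [norm_smul, norm_inv, norm_pow, norm_norm, norm_powMul _ _ ht0,
        Real.norm_of_nonneg ht0.le, mul_pow, ← Real.rpow_natCast (t ^ a), ← Real.rpow_mul ht0.le,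
        Real.rpow_sub ht0, Real.rpow_one, Nat.cast_ofNat, mul_comm a 2]
      have h1 : ‖f t‖ ^ 2 ≤ C ^ 2 := pow_le_pow_left₀ (norm_nonneg _) (hC t) 2
      have h2 : 0 ≤ t ^ (2 * a) / t := by positivity
      calc t⁻¹ * (t ^ (2 * a) * ‖f t‖ ^ 2) = ‖f t‖ ^ 2 * (t ^ (2 * a) / t) := by ring
        _ ≤ _ := mul_le_mul_of_nonneg_right h1 h2
  refine hi'.of_forall_sdiff_eq_zero measurableSet_Ioi fun t ht => ?_
  have : R < t := by
    by_contra hle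
    exact ht.2 ⟨ht.1, (not_lt.1 hle).trans (le_max_left _ _)⟩
  simp [powMul, hR t this]

theorem aestronglyMeasurable_of_memLp_powMul {a : ℝ} {f : ℝ → X}
    (hf : MemLp (powMul a f) 2 starMeasure) :
    AEStronglyMeasurable f (volume.restrict (Ioi 0)) := by
  refine (aestronglyMeasurable_powMul (-a)
    (hf.1.mono_ac absolutelyContinuous_starMeasure)).congr ?_
  filter_upwards [ae_restrict_mem measurableSet_Ioi] with t ht
  rw [powMul_powMul _ _ _ ht]
  simp [powMul]

/-- Weighted square integrable functions with weight exponent `a < 1` are integrable up to `0`; this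
is what gives traces at `0` to functions whose derivative is of this kind. -/
theorem integrableOn_Ioc_of_memLp {a : ℝ} (ha : a < 1) {f : ℝ → X}
    (hf : MemLp (powMul a f) 2 starMeasure) (R : ℝ) : IntegrableOn f (Ioc 0 R) := by
  have h1 : MemLp (powMul (1 - a) ((Iic R).indicator fun _ => (1 : ℂ))) 2 starMeasure := by
    refine memLp_powMul_of_bounded (C := 1) (R := R) (by linarith)
      (aestronglyMeasurable_const.indicator measurableSet_Iic) (fun t => ?_) fun t ht => ?_
    · by_cases h : t ∈ Iic R <;> simp [h]
    · exact indicator_of_notMem (s := Iic R) (not_le.2 ht) _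
  have h2 := integrableOn_bilin (ContinuousLinearMap.lsmul ℝ ℂ : ℂ →L[ℝ] X →L[ℝ] X).flip hf h1
  refine (h2.mono_set Ioc_subset_Ioi_self).congr ?_
  filter_upwards [ae_restrict_mem measurableSet_Ioc] with t ht
  simp [ht.2]

theorem memLp_powMul_powMul_iff {a b c : ℝ} (h : a + b = c) {f : ℝ → X} :
    MemLp (powMul a (powMul b f)) 2 starMeasure ↔ MemLp (powMul c f) 2 starMeasure := by
  refine memLp_congr_ae (ae_starMeasure_iff.2 ?_)
  filter_upwards [ae_restrict_mem measurableSet_Ioi] with t ht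
  rw [powMul_powMul _ _ _ ht, h]

theorem memLp_powMul_clm (L : X →L[ℂ] Y) {a : ℝ} {f : ℝ → X}
    (hf : MemLp (powMul a f) 2 starMeasure) :
    MemLp (powMul a fun t => L (f t)) 2 starMeasure :=
  (L.comp_memLp' hf).ae_eq (Eventually.of_forall fun t => by simp [powMul])

theorem memLp_powMul_congr {a : ℝ} {f g : ℝ → X} (hf : MemLp (powMul a f) 2 starMeasure)
    (h : f =ᵐ[volume.restrict (Ioi 0)] g) : MemLp (powMul a g) 2 starMeasure :=
  hf.ae_eq (ae_starMeasure_iff.2 (powMul_congr h))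

theorem memLp_powMul_sub {a : ℝ} {f g : ℝ → X} (hf : MemLp (powMul a f) 2 starMeasure)
    (hg : MemLp (powMul a g) 2 starMeasure) :
    MemLp (powMul a fun t => f t - g t) 2 starMeasure :=
  (hf.sub hg).ae_eq (Eventually.of_forall fun t => by simp [powMul, smul_sub])

theorem memLp_powMul_neg {a : ℝ} {f : ℝ → X} (hf : MemLp (powMul a f) 2 starMeasure) :
    MemLp (powMul a fun t => -f t) 2 starMeasure :=
  hf.neg.ae_eq (Eventually.of_forall fun t => by simp [powMul])

theorem locallyIntegrableOn_of_memLp {a : ℝ} (ha : a < 1) {f : ℝ → X}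
    (hf : MemLp (powMul a f) 2 starMeasure) : LocallyIntegrableOn f (Ioi 0) :=
  locallyIntegrableOn_of_Ioc (integrableOn_Ioc_of_memLp ha hf)

end Star

/-! ### Regularization in a Gelfand triple -/

section Resolvent

variable {V H : Type*} [NormedAddCommGroup V] [InnerProductSpace ℂ V] [CompleteSpace V]
  [NormedAddCommGroup H] [InnerProductSpace ℂ H] [CompleteSpace H]

open ContinuousLinearMap in
/-- The resolvent `(A* A + ε)⁻¹`, which exists by the Lax–Milgram theorem. -/
theorem exists_resolvent (A : V →L[ℂ] H) {ε : ℝ} (hε : 0 < ε) :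
    ∃ R : V →L[ℂ] V, (∀ v, adjoint A (A (R v)) + (ε : ℂ) • R v = v) ∧
      (∀ v, R (adjoint A (A v)) + (ε : ℂ) • R v = v) ∧ ∀ v, ε * ‖R v‖ ≤ ‖v‖ := by
  set S : V →L[ℂ] V := adjoint A ∘L A + (ε : ℂ) • ContinuousLinearMap.id ℂ V with hS
  have hre : ∀ v, ε * ‖v‖ ^ 2 ≤ (inner ℂ (S v) v).re := by
    intro v
    have h1 : inner ℂ (S v) v = inner ℂ (A v) (A v) + (ε : ℂ) * inner ℂ v v := by
      simp [hS, adjoint_inner_left]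
    have h2 : (inner ℂ v v).re = ‖v‖ ^ 2 := inner_self_eq_norm_sq (𝕜 := ℂ) v
    have h3 : (inner ℂ (A v) (A v)).re = ‖A v‖ ^ 2 := inner_self_eq_norm_sq (𝕜 := ℂ) (A v)
    rw [h1, Complex.add_re, Complex.re_ofReal_mul, h2, h3]
    linarith [sq_nonneg ‖A v‖]
  have hu : IsUnit S := by
    refine isUnit_of_forall_le_norm_inner_map S (c := ⟨ε, hε.le⟩) hε fun v => ?_
    rw [mul_comm]
    exact (hre v).trans (Complex.re_le_norm _)
  obtain ⟨U, hU⟩ := hu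
  have h1 : ∀ v, S ((↑U⁻¹ : V →L[ℂ] V) v) = v := fun v => by
    rw [← hU]; exact congrArg (fun f : V →L[ℂ] V => f v) U.mul_inv
  have h2 : ∀ v, (↑U⁻¹ : V →L[ℂ] V) (S v) = v := fun v => by
    rw [← hU]; exact congrArg (fun f : V →L[ℂ] V => f v) U.inv_mul
  refine ⟨↑U⁻¹, fun v => h1 v, fun v => ?_, fun v => ?_⟩
  · have := h2 v
    simpa [hS] using this
  · set r := (↑U⁻¹ : V →L[ℂ] V) v with hr
    have h3 := hre r
    rw [h1 v] at h3
    have h4 : (inner ℂ v r).re ≤ ‖v‖ * ‖r‖ :=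
      (Complex.re_le_norm _).trans (norm_inner_le_norm _ _)
    rcases (norm_nonneg r).eq_or_lt with h0 | h0
    · rw [← h0, mul_zero]; exact norm_nonneg _
    · refine le_of_mul_le_mul_right ?_ h0
      linarith [sq ‖r‖]

open ContinuousLinearMap in
/-- Strong convergence `ε (A* A + ε)⁻¹ → 0`. -/
theorem tendsto_smul_resolvent (A : V →L[ℂ] H) (hA : Function.Injective A) {ε : ℕ → ℝ}
    (hε : ∀ n, 0 < ε n) (hε0 : Tendsto ε atTop (𝓝 0)) {R : ℕ → V →L[ℂ] V}
    (h2 : ∀ n v, R n (adjoint A (A v)) + (ε n : ℂ) • R n v = v)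
    (h3 : ∀ n v, ε n * ‖R n v‖ ≤ ‖v‖) (v : V) :
    Tendsto (fun n => (ε n : ℂ) • R n v) atTop (𝓝 0) := by
  have hn : ∀ n v, ‖(ε n : ℂ) • R n v‖ ≤ ‖v‖ := fun n v => by
    rw [norm_smul, Complex.norm_real, Real.norm_of_nonneg (hε n).le]; exact h3 n v
  set T : V →L[ℂ] V := adjoint A ∘L A with hT
  have hdense : DenseRange T := by
    have : T.range.topologicalClosure = ⊤ := by
      rw [Submodule.topologicalClosure_eq_top_iff, orthogonal_range, LinearMap.ker_eq_bot']
      intro z hz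
      have h0 : inner ℂ (T z) z = 0 := by
        have : adjoint T = T := by simp [hT, adjoint_comp]
        rw [this] at hz
        change T z = 0 at hz
        rw [hz, inner_zero_left]
      rw [hT, comp_apply, adjoint_inner_left, inner_self_eq_zero] at h0
      exact hA (by rw [h0, map_zero])
    rw [DenseRange, dense_iff_closure_eq]
    exact congrArg (fun S : Submodule ℂ V => (S : Set V)) this
  rw [Metric.tendsto_atTop]
  intro δ hδ
  obtain ⟨z, hz⟩ := Metric.denseRange_iff.1 hdense v (δ / 2) (half_pos hδ)
  have hz' : Tendsto (fun n => ε n * (2 * ‖z‖)) atTop (𝓝 0) := by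
    simpa using hε0.mul_const (2 * ‖z‖)
  obtain ⟨N, hN⟩ := (hz'.eventually (gt_mem_nhds (half_pos hδ))).exists_forall_of_atTop
  refine ⟨N, fun n hnN => ?_⟩
  rw [dist_zero_right]
  have e : (ε n : ℂ) • R n v = (ε n : ℂ) • R n (v - T z) + (ε n : ℂ) • R n (T z) := by
    rw [map_sub, smul_sub, sub_add_cancel]
  have e2 : R n (T z) = z - (ε n : ℂ) • R n z := eq_sub_of_add_eq (h2 n z)
  have b2 : ‖(ε n : ℂ) • R n (T z)‖ ≤ ε n * (2 * ‖z‖) := by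
    rw [e2, norm_smul, Complex.norm_real, Real.norm_of_nonneg (hε n).le]
    refine mul_le_mul_of_nonneg_left ?_ (hε n).le
    linarith [norm_sub_le z ((ε n : ℂ) • R n z), hn n z]
  rw [e]
  have b1 := hn n (v - T z)
  rw [dist_eq_norm] at hz
  linarith [norm_add_le ((ε n : ℂ) • R n (v - T z)) ((ε n : ℂ) • R n (T z)), hN n hnN]

open ContinuousLinearMap in
/-- The operators `(ι* ι + ε)⁻¹ ι*` approximate the inverse of `ι`: they map `H` to `V` and converge
strongly to the identity both on `V` and on `H`. -/
theorem exists_regularization (ι : V →L[ℂ] H) (hι : Function.Injective ι) (hd : DenseRange ι) :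
    ∃ J : ℕ → H →L[ℂ] V, (∀ n v, ‖J n (ι v)‖ ≤ 2 * ‖v‖) ∧
      (∀ v, Tendsto (fun n => J n (ι v)) atTop (𝓝 v)) ∧
      (∀ n h, ‖ι (J n h)‖ ≤ 2 * ‖h‖) ∧ ∀ h, Tendsto (fun n => ι (J n h)) atTop (𝓝 h) := by
  obtain ⟨ε, hε, hε0⟩ : ∃ ε : ℕ → ℝ, (∀ n, 0 < ε n) ∧ Tendsto ε atTop (𝓝 0) :=
    ⟨_, fun n => Nat.one_div_pos_of_nat, tendsto_one_div_add_atTop_nhds_zero_nat⟩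
  have hadj : Function.Injective (adjoint ι) := by
    rw [injective_iff_map_eq_zero]
    intro h hh
    refine hd.eq_zero_of_inner_left (𝕜 := ℂ) fun v => ?_
    rw [← adjoint_inner_left, hh, inner_zero_left]
  choose R hR1 hR2 hR3 using fun n => exists_resolvent ι (hε n)
  choose S hS1 hS2 hS3 using fun n => exists_resolvent (adjoint ι) (hε n)
  simp only [adjoint_adjoint] at hS1 hS2
  have hV : ∀ n v, R n (adjoint ι (ι v)) = v - (ε n : ℂ) • R n v :=
    fun n v => eq_sub_of_add_eq (hR2 n v)
  have hH : ∀ n h, ι (R n (adjoint ι h)) = h - (ε n : ℂ) • S n h := by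
    intro n h
    have h1 : adjoint ι (ι (adjoint ι (S n h))) +
        (ε n : ℂ) • adjoint ι (S n h) = adjoint ι h := by
      rw [← map_smul, ← map_add, hS1]
    have h2 : R n (adjoint ι h) = adjoint ι (S n h) := by
      rw [← h1, map_add, map_smul, hR2]
    rw [h2]
    exact eq_sub_of_add_eq (hS1 n h)
  have hnR : ∀ n v, ‖(ε n : ℂ) • R n v‖ ≤ ‖v‖ := fun n v => by
    rw [norm_smul, Complex.norm_real, Real.norm_of_nonneg (hε n).le]; exact hR3 n v
  have hnS : ∀ n v, ‖(ε n : ℂ) • S n v‖ ≤ ‖v‖ := fun n v => by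
    rw [norm_smul, Complex.norm_real, Real.norm_of_nonneg (hε n).le]; exact hS3 n v
  refine ⟨fun n => R n ∘L adjoint ι, fun n v => ?_, fun v => ?_, fun n h => ?_, fun h => ?_⟩
  · simp only [comp_apply, hV]
    linarith [norm_sub_le v ((ε n : ℂ) • R n v), hnR n v]
  · simp only [comp_apply, hV]
    simpa using (tendsto_const_nhds (x := v)).sub (tendsto_smul_resolvent ι hι hε hε0 hR2 hR3 v)
  · simp only [comp_apply, hH]
    linarith [norm_sub_le h ((ε n : ℂ) • S n h), hnS n h]
  · simp only [comp_apply, hH]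
    simpa using (tendsto_const_nhds (x := h)).sub
      (tendsto_smul_resolvent (adjoint ι) hadj hε hε0
        (by simpa only [adjoint_adjoint] using hS2) hS3 h)

end Resolvent

/-! ### The energy identity -/

section Energy

/-- The product rule `∫₀ᵀ (B(a, v) + B(u, b)) = B(u(T), v(T)) - B(u(0), v(0))` for primitives `u` of `a`
and `v` of `b`. -/
theorem integral_bilin_primitive {X Y Z : Type*} [NormedAddCommGroup X] [NormedAddCommGroup Y]
    [NormedAddCommGroup Z] [NormedSpace ℝ X] [NormedSpace ℝ Y] [NormedSpace ℝ Z]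
    [CompleteSpace X] [CompleteSpace Y] [CompleteSpace Z]
    (B : X →L[ℝ] Y →L[ℝ] Z) {a : ℝ → X} {b : ℝ → Y} (x : X) (y : Y) {T : ℝ} (hT : 0 ≤ T)
    (ha : ∀ R : ℝ, IntegrableOn a (Ioc 0 R)) (hb : ∀ R : ℝ, IntegrableOn b (Ioc 0 R)) :
    ∫ t in Ioc 0 T, (B (a t) (y + ∫ τ in (0 : ℝ)..t, b τ) + B (x + ∫ τ in (0 : ℝ)..t, a τ) (b t)) =
    B (x + ∫ t in (0 : ℝ)..T, a t) (y + ∫ t in (0 : ℝ)..T, b t) - B x y := by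
  have ca : ContinuousOn (fun t => ∫ τ in (0 : ℝ)..t, a τ) (Icc 0 T) :=
    (continuousOn_primitive_Ici ha).mono Icc_subset_Ici_self
  have cb : ContinuousOn (fun t => ∫ τ in (0 : ℝ)..t, b τ) (Icc 0 T) :=
    (continuousOn_primitive_Ici hb).mono Icc_subset_Ici_self
  obtain ⟨Ca, hCa⟩ := isCompact_Icc.exists_bound_of_continuousOn ca
  obtain ⟨Cb, hCb⟩ := isCompact_Icc.exists_bound_of_continuousOn cb
  have i1 : IntegrableOn (fun t => B (a t) y) (Ioc 0 T) := (B.flip y).integrable_comp (ha T)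
  have i2 : IntegrableOn (fun t => B x (b t)) (Ioc 0 T) := (B x).integrable_comp (hb T)
  have i3 : IntegrableOn (fun t => B (a t) (∫ τ in (0 : ℝ)..t, b τ)) (Ioc 0 T) :=
    B.integrable_of_bilin_of_bdd_right Cb (ha T)
      ((cb.mono Ioc_subset_Icc_self).aestronglyMeasurable measurableSet_Ioc)
      ((ae_restrict_mem measurableSet_Ioc).mono fun t ht => hCb t (Ioc_subset_Icc_self ht))
  have i4 : IntegrableOn (fun t => B (∫ τ in (0 : ℝ)..t, a τ) (b t)) (Ioc 0 T) :=
    B.integrable_of_bilin_of_bdd_left Ca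
      ((ca.mono Ioc_subset_Icc_self).aestronglyMeasurable measurableSet_Ioc)
      ((ae_restrict_mem measurableSet_Ioc).mono fun t ht => hCa t (Ioc_subset_Icc_self ht)) (hb T)
  have e1 : ∫ t in Ioc 0 T, B (a t) y = B (∫ t in (0 : ℝ)..T, a t) y := by
    rw [intervalIntegral.integral_of_le hT]
    exact (B.flip y).integral_comp_comm (ha T)
  have e2 : ∫ t in Ioc 0 T, B x (b t) = B x (∫ t in (0 : ℝ)..T, b t) := by
    rw [intervalIntegral.integral_of_le hT]
    exact (B x).integral_comp_comm (hb T)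
  simp only [map_add, add_apply]
  have i13 : IntegrableOn (fun t => B (a t) y + B (a t) (∫ τ in (0 : ℝ)..t, b τ)) (Ioc 0 T) :=
    i1.add i3
  have i24 : IntegrableOn (fun t => B x (b t) + B (∫ τ in (0 : ℝ)..t, a τ) (b t)) (Ioc 0 T) :=
    i2.add i4
  rw [integral_add i13 i24, integral_add i1 i3, integral_add i2 i4, e1, e2,
    add_add_add_comm, integral_bilin_primitive_add B hT (ha T) (hb T)]
  abel

variable {V H : Type*} [NormedAddCommGroup V] [InnerProductSpace ℂ V]
  [NormedAddCommGroup H] [InnerProductSpace ℂ H]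

variable (V) in
/-- The duality pairing `(w, v) ↦ ⟨w, v⟩` of `V'` and `V`, as a real bilinear map. -/
noncomputable def pairing : (V →L⋆[ℂ] ℂ) →L[ℝ] V →L[ℝ] ℂ :=
  LinearMap.mkContinuous₂
    (LinearMap.mk₂ ℝ (fun (w : V →L⋆[ℂ] ℂ) (v : V) => w v) (fun _ _ _ => rfl) (fun _ _ _ => rfl)
      (fun w v v' => map_add w v v') fun c w v => by
        rw [← Complex.coe_smul, map_smulₛₗ, Complex.conj_ofReal, Complex.coe_smul])
    1 fun w v => by simpa using w.le_opNorm v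

theorem pairing_apply (w : V →L⋆[ℂ] ℂ) (v : V) : pairing V w v = w v := rfl

/-- The scalar product `(h, k) ↦ (h | k)` of `H`, antilinear in `k`, as a real bilinear map. -/
noncomputable def innerPairing (H : Type*) [NormedAddCommGroup H] [InnerProductSpace ℂ H] :
    H →L[ℝ] H →L[ℝ] ℂ :=
  LinearMap.mkContinuous₂
    (LinearMap.mk₂ ℝ (fun (h : H) (k : H) => inner ℂ k h) (fun _ _ _ => inner_add_right _ _ _)
      (fun c h k => by rw [← Complex.coe_smul, inner_smul_right]; simp)
      (fun _ _ _ => inner_add_left _ _ _)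
      fun c w v => by rw [← Complex.coe_smul, inner_smul_left]; simp)
    1 fun w v => by simpa [mul_comm] using norm_inner_le_norm v w

theorem innerPairing_apply (h k : H) : innerPairing H h k = inner ℂ k h := rfl

variable [CompleteSpace V] [CompleteSpace H]

/-- The product rule for the pairing of `w ∈ W_s(V', H)` with `u ∈ W_{1-s}(H, V)`, integrated over
the half-line, when one of the two boundary values at `0` vanishes. The product rule is not
available directly, since `u'` takes values in `H` only and `w'` in `V'`; it is applied to the
regularization `J n (ι u)` of `u`, whose derivative `J n u'` takes values in `V`. -/
theorem integral_energy_eq_zero (ι : V →L[ℂ] H) (hι : Function.Injective ι) (hd : DenseRange ι)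
    {s : ℝ} {u : ℝ → V} {u' w : ℝ → H} {w' : ℝ → V →L⋆[ℂ] ℂ} {x : H} {y : V →L⋆[ℂ] ℂ}
    (hu : IsPrimitive x (fun t => ι (u t)) u')
    (hw : IsPrimitive y (fun t => toAntidual ι (w t)) w') (hxy : x = 0 ∨ y = 0)
    (mu : MemLp (powMul (1 - s) u) 2 starMeasure) (mu' : MemLp (powMul (1 - s) u') 2 starMeasure)
    (mw : MemLp (powMul s w) 2 starMeasure) (mw' : MemLp (powMul s w') 2 starMeasure) :
    ∫ t in Ioi (0 : ℝ), (w' t (u t) + inner ℂ (u' t) (w t)) = 0 := by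
  obtain ⟨J, hJ1, hJ2, hJ3, hJ4⟩ := exists_regularization ι hι hd
  set q : ℝ → ℂ := fun t => w' t (u t) + inner ℂ (u' t) (w t) with hq
  have i1 : IntegrableOn (fun t => w' t (u t)) (Ioi 0) := integrableOn_bilin (pairing V) mw' mu
  have i2 : IntegrableOn (fun t => inner ℂ (u' t) (w t)) (Ioi 0) :=
    integrableOn_bilin (innerPairing H) mw mu'
  have n1 := integrableOn_norm_mul_norm mw' mu
  have n2 := integrableOn_norm_mul_norm mw mu'
  have mιu : MemLp (powMul (1 - s) fun t => ι (u t)) 2 starMeasure := memLp_powMul_clm ι mu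
  have i3 : IntegrableOn (fun t => inner ℂ (ι (u t)) (w t)) (Ioi 0) :=
    integrableOn_bilin (innerPairing H) mw mιu
  have iq : IntegrableOn q (Ioi 0) := i1.add i2
  -- the regularized identity on `(0, T]`
  have hreg : ∀ᵐ T ∂volume.restrict (Ioi (0 : ℝ)), ∀ n,
      ∫ t in Ioc 0 T, (w' t (J n (ι (u t))) + inner ℂ (ι (J n (u' t))) (w t)) =
        inner ℂ (ι (J n (ι (u T)))) (w T) := by
    filter_upwards [hu.ae_eq, hw.ae_eq, ae_restrict_mem measurableSet_Ioi] with T hTu hTw hT n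
    have hT0 : (0 : ℝ) < T := hT
    have hJ : ∀ t : ℝ, 0 < t →
        J n x + ∫ τ in (0 : ℝ)..t, J n (u' τ) = J n (x + ∫ τ in (0 : ℝ)..t, u' τ) := fun t ht => by
      rw [map_add, (J n).intervalIntegral_comp_comm
        (intervalIntegrable_of_Ioc hu.integrableOn le_rfl ht.le)]
    have key := integral_bilin_primitive (pairing V) y (J n x) hT0.le hw.integrableOn
      fun R => (J n).integrable_comp (hu.integrableOn R)
    rw [hJ T hT0, ← hTu, ← hTw] at key
    simp only [pairing_apply, toAntidual_apply] at key
    have h0 : y (J n x) = 0 := by rcases hxy with rfl | rfl <;> simp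
    rw [h0, sub_zero] at key
    rw [← key]
    refine integral_congr_ae ?_
    filter_upwards [ae_restrict_of_ae_restrict_of_subset Ioc_subset_Ioi_self hu.ae_eq,
      ae_restrict_of_ae_restrict_of_subset Ioc_subset_Ioi_self hw.ae_eq,
      ae_restrict_mem measurableSet_Ioc] with t h1 h2 ht
    rw [hJ t ht.1, ← h1, ← h2, toAntidual_apply]
  -- the regularization is removed by dominated convergence
  have hlim : ∀ᵐ T ∂volume.restrict (Ioi (0 : ℝ)),
      ∫ t in Ioc 0 T, q t = inner ℂ (ι (u T)) (w T) := by
    filter_upwards [hreg, ae_restrict_mem measurableSet_Ioi] with T hT hT0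
    have l1 : Tendsto (fun n => inner ℂ (ι (J n (ι (u T)))) (w T)) atTop
        (𝓝 (inner ℂ (ι (u T)) (w T))) :=
      (hJ4 (ι (u T))).inner tendsto_const_nhds
    have l2 : Tendsto (fun n => ∫ t in Ioc 0 T,
        (w' t (J n (ι (u t))) + inner ℂ (ι (J n (u' t))) (w t))) atTop
        (𝓝 (∫ t in Ioc 0 T, q t)) := by
      have hsub : volume.restrict (Ioc 0 T) ≤ volume.restrict (Ioi (0 : ℝ)) :=
        Measure.restrict_mono Ioc_subset_Ioi_self le_rfl
      have su := (aestronglyMeasurable_of_memLp_powMul mu).mono_measure hsub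
      have su' := (aestronglyMeasurable_of_memLp_powMul mu').mono_measure hsub
      have sw := (aestronglyMeasurable_of_memLp_powMul mw).mono_measure hsub
      have sw' := (aestronglyMeasurable_of_memLp_powMul mw').mono_measure hsub
      refine tendsto_integral_of_dominated_convergence
        (fun t => 2 * (‖w' t‖ * ‖u t‖) + 2 * (‖w t‖ * ‖u' t‖)) (fun n => ?_)
        (((n1.const_mul 2).add (n2.const_mul 2)).mono_measure hsub)
        (fun n => Eventually.of_forall fun t => ?_) (Eventually.of_forall fun t => ?_)
      · refine AEStronglyMeasurable.add ?_ ?_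
        · exact (pairing V).aestronglyMeasurable_comp₂ sw'
            ((J n).continuous.comp_aestronglyMeasurable (ι.continuous.comp_aestronglyMeasurable su))
        · exact (ι.continuous.comp_aestronglyMeasurable
            ((J n).continuous.comp_aestronglyMeasurable su')).inner sw
      · refine (norm_add_le _ _).trans (add_le_add ?_ ?_)
        · refine ((w' t).le_opNorm _).trans ?_
          nlinarith [mul_le_mul_of_nonneg_left (hJ1 n (u t)) (norm_nonneg (w' t))]
        · refine (norm_inner_le_norm _ _).trans ?_
          nlinarith [mul_le_mul_of_nonneg_left (hJ3 n (u' t)) (norm_nonneg (w t))]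
      · exact (((w' t).continuous.tendsto _).comp (hJ2 (u t))).add
          ((hJ4 (u' t)).inner tendsto_const_nhds)
    exact tendsto_nhds_unique l2 (l1.congr fun n => (hT n).symm)
  have hconv : Tendsto (fun T => ∫ t in (0 : ℝ)..T, q t) atTop (𝓝 (∫ t in Ioi (0 : ℝ), q t)) :=
    intervalIntegral_tendsto_integral_Ioi 0 iq tendsto_id
  -- the boundary term at `T` is an integrable function of `T`, so that its limit is zero
  have hI : IntegrableOn (fun T => ∫ t in (0 : ℝ)..T, q t) (Ioi 0) := by
    refine i3.congr ?_
    filter_upwards [hlim, ae_restrict_mem measurableSet_Ioi] with T hT hT0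
    rw [← hT, intervalIntegral.integral_of_le (le_of_lt hT0)]
  refine IntegrableAtFilter.eq_zero_of_tendsto (l := atTop) (μ := volume)
    ⟨Ioi 0, Ioi_mem_atTop 0, hI⟩ (fun S hS => ?_) hconv
  obtain ⟨b, hb⟩ := mem_atTop_sets.1 hS
  rw [← top_le_iff, ← Real.volume_Ici (a := b)]
  exact measure_mono hb

end Energy

/-! ### Complex interpolation spaces as trace spaces -/

section Fourier

open scoped FourierTransform SchwartzMap

theorem continuous_fourier_of_integrable {E : Type*} [NormedAddCommGroup E] [NormedSpace ℂ E]
    {f : ℝ → E} (hf : Integrable f) : Continuous (𝓕 f) :=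
  VectorFourier.fourierIntegral_continuous Real.continuous_fourierChar
    (by exact continuous_inner) hf

theorem norm_fourier_le {E : Type*} [NormedAddCommGroup E] [NormedSpace ℂ E]
    (f : ℝ → E) (ξ : ℝ) : ‖𝓕 f ξ‖ ≤ ∫ τ, ‖f τ‖ :=
  VectorFourier.norm_fourierIntegral_le_integral_norm _ _ _ _ _

theorem integrable_exp_smul {E : Type*} [NormedAddCommGroup E] [NormedSpace ℂ E]
    {f : ℝ → E} (hf : Integrable f) (ξ : ℝ) :
    Integrable fun τ : ℝ => Complex.exp (↑(-2 * Real.pi * τ * ξ) * Complex.I) • f τ := by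
  refine hf.bdd_smul 1 (Continuous.aestronglyMeasurable (by fun_prop))
    (Eventually.of_forall fun τ => ?_)
  rw [Complex.norm_exp_ofReal_mul_I]

theorem fourier_clm_comp {E F : Type*} [NormedAddCommGroup E] [NormedSpace ℂ E]
    [NormedAddCommGroup F] [NormedSpace ℂ F] [CompleteSpace E] [CompleteSpace F]
    (L : E →L[ℂ] F) {f : ℝ → E} (hf : Integrable f) (ξ : ℝ) :
    𝓕 (fun τ => L (f τ)) ξ = L (𝓕 f ξ) := by
  rw [Real.fourier_real_eq_integral_exp_smul, Real.fourier_real_eq_integral_exp_smul,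
    ← L.integral_comp_comm]
  · simp
  · exact integrable_exp_smul hf ξ

/-- Plancherel's theorem, for the Fourier integral of an integrable square integrable function. -/
theorem memLp_fourier {F : Type*} [NormedAddCommGroup F] [InnerProductSpace ℂ F] [CompleteSpace F]
    {f : ℝ → F} (hf : Integrable f) (hf2 : MemLp f 2) : MemLp (𝓕 f) 2 := by
  set g : Lp F 2 (volume : Measure ℝ) := 𝓕 (hf2.toLp f) with hg
  have hcont := continuous_fourier_of_integrable hf
  have hloc : LocallyIntegrable (fun ξ => 𝓕 f ξ - g ξ) :=
    hcont.locallyIntegrable.sub ((Lp.memLp g).locallyIntegrable (by norm_num))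
  have key : ∀ᵐ ξ, 𝓕 f ξ - g ξ = 0 := by
    refine ae_eq_zero_of_integral_contDiff_smul_eq_zero hloc fun φ hφ hφc => ?_
    have hφ' : ContDiff ℝ ∞ (fun t => (φ t : ℂ)) := Complex.ofRealCLM.contDiff.comp hφ
    have hφc' : HasCompactSupport (fun t => (φ t : ℂ)) := hφc.comp_left Complex.ofReal_zero
    set ψ : 𝓢(ℝ, ℂ) := hφc'.toSchwartzMap hφ' with hψ
    have h1 := congrArg (fun T => T ψ) (Lp.fourier_toTemperedDistribution_eq (hf2.toLp f))
    simp only [TemperedDistribution.fourier_apply, Lp.toTemperedDistribution_apply] at h1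
    have h2 : ∫ ξ, (𝓕 ψ : 𝓢(ℝ, ℂ)) ξ • (hf2.toLp f) ξ = ∫ ξ, (𝓕 (ψ : ℝ → ℂ) ξ) • f ξ := by
      refine integral_congr_ae ?_
      filter_upwards [hf2.coeFn_toLp] with ξ hξ
      rw [hξ, SchwartzMap.fourier_coe]
    have h3 : ∫ ξ, (𝓕 (ψ : ℝ → ℂ) ξ) • f ξ = ∫ ξ, ψ ξ • 𝓕 f ξ := by
      have := VectorFourier.integral_fourierIntegral_smul_eq_flip (μ := volume) (ν := volume)
        (L := innerₗ ℝ) Real.continuous_fourierChar (by exact continuous_inner)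
        ψ.integrable hf
      rw [flip_innerₗ] at this
      exact this
    have hi1 : Integrable (fun ξ => φ ξ • 𝓕 f ξ) :=
      (hφ.continuous.smul hcont).integrable_of_hasCompactSupport hφc.smul_right
    have hi2 : Integrable (fun ξ => φ ξ • g ξ) :=
      ((Lp.memLp g).locallyIntegrable (by norm_num)).integrable_smul_left_of_hasCompactSupport
        hφ.continuous hφc
    simp only [smul_sub]
    rw [integral_sub hi1 hi2, sub_eq_zero]
    have h4 := (h3.symm.trans h2.symm).trans h1
    simpa [hψ] using h4
  refine (Lp.memLp g).ae_eq ?_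
  filter_upwards [key] with ξ hξ
  exact (sub_eq_zero.1 hξ).symm

/-- Cauchy's theorem in a strip: integrals over vertical lines agree. -/
theorem integral_vertical_line_eq {X : Type*} [NormedAddCommGroup X] [NormedSpace ℂ X]
    [CompleteSpace X] {F : ℂ → X} (hc : ContinuousOn F {z : ℂ | 0 ≤ z.re ∧ z.re ≤ 1})
    (hd : DifferentiableOn ℂ F {z : ℂ | 0 < z.re ∧ z.re < 1}) {C : ℝ}
    (hb : ∀ c τ : ℝ, 0 ≤ c → c ≤ 1 → ‖F (c + τ * Complex.I)‖ ≤ C * Real.exp (-τ ^ 2))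
    {c₁ c₂ : ℝ} (h0 : 0 ≤ c₁) (h12 : c₁ ≤ c₂) (h1 : c₂ ≤ 1) :
    ∫ τ : ℝ, F (c₁ + τ * Complex.I) = ∫ τ : ℝ, F (c₂ + τ * Complex.I) := by
  have hint : ∀ c : ℝ, 0 ≤ c → c ≤ 1 → Integrable fun τ : ℝ => F (c + τ * Complex.I) := by
    intro c hc0 hc1
    have hcont : Continuous fun τ : ℝ => F (c + τ * Complex.I) := by
      rw [← continuousOn_univ]
      exact hc.comp (by fun_prop) fun τ _ => by simp [hc0, hc1]
    refine Integrable.mono' (g := fun τ => C * Real.exp (-τ ^ 2)) ?_ hcont.aestronglyMeasurable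
      (Eventually.of_forall fun τ => hb c τ hc0 hc1)
    simpa using (integrable_exp_neg_mul_sq one_pos).const_mul C
  have hrect : ∀ T : ℝ, 0 < T →
      (∫ x : ℝ in c₁..c₂, F (x + ((-T : ℝ) : ℂ) * Complex.I)) -
        (∫ x : ℝ in c₁..c₂, F (x + (T : ℂ) * Complex.I)) +
      Complex.I • (∫ y : ℝ in (-T)..T, F (c₂ + y * Complex.I)) -
      Complex.I • (∫ y : ℝ in (-T)..T, F (c₁ + y * Complex.I)) = 0 := by
    intro T hT
    refine Complex.integral_boundary_rect_eq_zero_of_continuousOn_of_differentiableOn F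
      ⟨c₁, -T⟩ ⟨c₂, T⟩ (hc.mono ?_) (hd.mono ?_)
    · rintro z ⟨hz, -⟩
      simp only [mem_preimage, uIcc_of_le h12] at hz
      exact ⟨h0.trans hz.1, hz.2.trans h1⟩
    · rintro z ⟨hz, -⟩
      simp only [mem_preimage, min_eq_left h12, max_eq_right h12] at hz
      exact ⟨h0.trans_lt hz.1, hz.2.trans_le h1⟩
  have hgauss : Tendsto (fun T : ℝ => C * Real.exp (-T ^ 2) * |c₂ - c₁|) atTop (𝓝 0) := by
    have : Tendsto (fun T : ℝ => Real.exp (-T ^ 2)) atTop (𝓝 0) :=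
      Real.tendsto_exp_atBot.comp (tendsto_neg_atTop_atBot.comp (tendsto_pow_atTop two_ne_zero))
    simpa using (this.const_mul C).mul_const |c₂ - c₁|
  have hhor : ∀ σ : ℝ → ℝ, (∀ T, σ T ^ 2 = T ^ 2) →
      Tendsto (fun T : ℝ => ∫ x : ℝ in c₁..c₂, F (x + (σ T : ℂ) * Complex.I)) atTop (𝓝 0) := by
    intro σ hσ
    refine squeeze_zero_norm (fun T => ?_) hgauss
    refine intervalIntegral.norm_integral_le_of_norm_le_const fun x hx => ?_
    rw [uIoc_of_le h12] at hx
    rw [← hσ T]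
    exact hb x (σ T) (h0.trans hx.1.le) (hx.2.trans h1)
  have hver : ∀ c : ℝ, 0 ≤ c → c ≤ 1 →
      Tendsto (fun T : ℝ => Complex.I • ∫ y : ℝ in (-T)..T, F (c + y * Complex.I)) atTop
        (𝓝 (Complex.I • ∫ y : ℝ, F (c + y * Complex.I))) := fun c hc0 hc1 =>
    (intervalIntegral_tendsto_integral (hint c hc0 hc1) tendsto_neg_atTop_atBot
      tendsto_id).const_smul _
  have hlim := (((hhor (fun T => -T) (by simp)).sub (hhor id (by simp))).add
    (hver c₂ (h0.trans h12) h1)).sub (hver c₁ h0 (h12.trans h1))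
  have hz := tendsto_nhds_unique hlim (tendsto_const_nhds.congr' (by
    filter_upwards [eventually_gt_atTop 0] with T hT using (hrect T hT).symm))
  rw [sub_zero, zero_add, ← smul_sub, smul_eq_zero, sub_eq_zero] at hz
  exact (hz.resolve_left Complex.I_ne_zero).symm

theorem integrable_of_gaussian {E : Type*} [NormedAddCommGroup E] [NormedSpace ℂ E] {f : ℝ → E}
    (hf : Continuous f) {C : ℝ} (hb : ∀ τ, ‖f τ‖ ≤ C * Real.exp (-τ ^ 2)) :
    Integrable f ∧ MemLp f 2 := by
  have h1 : Integrable f := by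
    refine Integrable.mono' (g := fun τ => C * Real.exp (-τ ^ 2)) ?_ hf.aestronglyMeasurable
      (Eventually.of_forall hb)
    simpa using (integrable_exp_neg_mul_sq one_pos).const_mul C
  refine ⟨h1, ?_⟩
  rw [memLp_two_iff_integrable_sq_norm hf.aestronglyMeasurable]
  refine (h1.norm.const_mul |C|).mono' (hf.norm.pow 2).aestronglyMeasurable
    (Eventually.of_forall fun τ => ?_)
  have h2 : ‖f τ‖ ≤ |C| := by
    refine (hb τ).trans ((le_abs_self _).trans ?_)
    rw [abs_mul, Real.abs_exp]
    exact mul_le_of_le_one_right (abs_nonneg _) (Real.exp_le_one_iff.2 (by nlinarith [sq_nonneg τ]))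
  rw [norm_pow, norm_norm, sq]
  exact mul_le_mul_of_nonneg_right h2 (norm_nonneg _)

theorem memLp_comp_log {E : Type*} [NormedAddCommGroup E] {g : ℝ → E} (hg : Continuous g)
    (h : MemLp g 2) : MemLp (fun t => g (Real.log t / (2 * Real.pi))) 2 starMeasure := by
  have hm : AEStronglyMeasurable (fun t => g (Real.log t / (2 * Real.pi)))
      (Measure.map (fun ξ : ℝ => Real.exp (2 * Real.pi * ξ))
      (ENNReal.ofReal (2 * Real.pi) • (volume : Measure ℝ))) :=
    hg.comp_aestronglyMeasurable (Real.measurable_log.div_const _).aestronglyMeasurable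
  rw [← map_exp_volume, memLp_map_measure_iff hm (by fun_prop)]
  refine MemLp.smul_measure ?_ ENNReal.ofReal_ne_top
  refine h.ae_eq (Eventually.of_forall fun ξ => ?_)
  rw [Function.comp_apply, Real.log_exp, mul_div_cancel_left₀ _ (by positivity)]

variable {X Y : Type*} [NormedAddCommGroup X] [NormedSpace ℂ X] [CompleteSpace X]
  [NormedAddCommGroup Y] [InnerProductSpace ℂ Y] [CompleteSpace Y]

/-- `∫₀^∞ t⁻¹ 𝓕 h (log t / 2π) dt = 2π h(0)`: Fourier inversion at `0` after the substitution
`t = exp (2 π ξ)`. -/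
theorem integral_inv_smul_fourier_log {h : ℝ → X} (hc : Continuous h) (hi : Integrable h)
    (hF : IntegrableOn (fun t => t⁻¹ • 𝓕 h (Real.log t / (2 * Real.pi))) (Ioi 0)) :
    ∫ t in Ioi (0 : ℝ), t⁻¹ • 𝓕 h (Real.log t / (2 * Real.pi)) = (2 * Real.pi) • h 0 := by
  have hpi : 0 < 2 * Real.pi := by positivity
  have hcF := continuous_fourier_of_integrable hi
  have hm : AEStronglyMeasurable (fun t => 𝓕 h (Real.log t / (2 * Real.pi)))
      (Measure.map (fun ξ : ℝ => Real.exp (2 * Real.pi * ξ))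
      (ENNReal.ofReal (2 * Real.pi) • (volume : Measure ℝ))) :=
    hcF.comp_aestronglyMeasurable (Real.measurable_log.div_const _).aestronglyMeasurable
  have he : ∀ ξ : ℝ, Real.log (Real.exp (2 * Real.pi * ξ)) / (2 * Real.pi) = ξ := fun ξ => by
    rw [Real.log_exp, mul_div_cancel_left₀ _ hpi.ne']
  have hFi : Integrable (𝓕 h) := by
    have h1 := integrable_starMeasure_iff.2 hF
    rw [← map_exp_volume, integrable_map_measure hm (by fun_prop),
      integrable_smul_measure (by simpa using hpi) ENNReal.ofReal_ne_top] at h1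
    refine h1.congr (Eventually.of_forall fun ξ => ?_)
    rw [Function.comp_apply, he]
  rw [← integral_starMeasure, ← map_exp_volume, integral_map (by fun_prop) hm,
    integral_smul_measure, ENNReal.toReal_ofReal hpi.le]
  simp only [he]
  congr 1
  have := congrFun (hc.fourierInv_fourier_eq hi hFi) 0
  rw [Real.fourierInv_eq] at this
  simpa using this

/-- The elements of `[X, Y]_θ` are traces at `0` of functions in `W_{1-θ}(X, Y)`. The function is the
inverse Mellin transform of `z ↦ f z * exp ((z - θ) ^ 2) / (z - θ)`, taken along `Re z = 1`, and its
derivative is computed along `Re z = 0`; the weighted norms are then Plancherel norms. -/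
theorem exists_isPrimitive_of_mem_complexInterp
    (hX : ∀ g : ℝ → X, Integrable g → MemLp g 2 → MemLp (𝓕 g) 2)
    (j : Y →L[ℂ] X) {θ : ℝ} (hθ0 : 0 < θ) (hθ1 : θ < 1) {x : X}
    (hx : x ∈ complexInterp (ContinuousLinearMap.id ℂ X) j θ) :
    ∃ (u : ℝ → Y) (v : ℝ → X), MemLp (powMul (1 - θ) u) 2 starMeasure ∧
      MemLp (powMul (1 - θ) v) 2 starMeasure ∧ IsPrimitive x (fun t => j (u t)) v := by
  have hpi : 0 < 2 * Real.pi := by positivity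
  obtain ⟨f, hf, hfx⟩ := hx
  obtain ⟨C, hC⟩ := hf.bounded
  obtain ⟨g, hg⟩ := hf.right
  have hC0 : 0 ≤ C := (norm_nonneg _).trans (hC 0 (by simp) (by simp))
  -- the Gaussian factor makes everything integrable and equals `1` at `θ`
  set G : ℂ → ℂ := fun z => Complex.exp ((z - θ) ^ 2) with hG
  have hGnorm : ∀ c τ : ℝ, ‖G (c + τ * Complex.I)‖ = Real.exp ((c - θ) ^ 2) * Real.exp (-τ ^ 2) := by
    intro c τ
    rw [hG, Complex.norm_exp, ← Real.exp_add]
    congr 1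
    have : ((c : ℂ) + τ * Complex.I - θ) ^ 2 =
        (((c - θ) ^ 2 - τ ^ 2 : ℝ) : ℂ) + ((2 * (c - θ) * τ : ℝ) : ℂ) * Complex.I := by
      push_cast
      linear_combination (τ : ℂ) ^ 2 * Complex.I_sq
    rw [this, Complex.add_re, Complex.re_ofReal_mul, Complex.ofReal_re, Complex.I_re]
    ring
  have hGb : ∀ c τ : ℝ, 0 ≤ c → c ≤ 1 →
      ‖G (c + τ * Complex.I)‖ ≤ Real.exp 1 * Real.exp (-τ ^ 2) := by
    intro c τ h0 h1
    rw [hGnorm]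
    refine mul_le_mul_of_nonneg_right (Real.exp_le_exp.2 ?_) (Real.exp_pos _).le
    nlinarith
  set P : ℝ → ℝ → X := fun c τ => G (c + τ * Complex.I) • f (c + τ * Complex.I) with hP
  have hfc : ∀ c : ℝ, 0 ≤ c → c ≤ 1 → Continuous fun τ : ℝ => f (c + τ * Complex.I) := by
    intro c h0 h1
    rw [← continuousOn_univ]
    exact hf.continuousOn.comp (by fun_prop) fun τ _ => by simp [h0, h1]
  have hPc : ∀ c : ℝ, 0 ≤ c → c ≤ 1 → Continuous (P c) := fun c h0 h1 =>
    Continuous.smul (by fun_prop) (hfc c h0 h1)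
  have hPb : ∀ c τ : ℝ, 0 ≤ c → c ≤ 1 → ‖P c τ‖ ≤ (Real.exp 1 * C) * Real.exp (-τ ^ 2) := by
    intro c τ h0 h1
    rw [hP, norm_smul]
    calc _ ≤ (Real.exp 1 * Real.exp (-τ ^ 2)) * C :=
          mul_le_mul (hGb c τ h0 h1) (hC _ (by simpa using h0) (by simpa using h1)) (norm_nonneg _)
            (by positivity)
      _ = _ := by ring
  have hPi : ∀ c : ℝ, 0 ≤ c → c ≤ 1 → Integrable (P c) ∧ MemLp (P c) 2 := fun c h0 h1 =>
    integrable_of_gaussian (hPc c h0 h1) fun τ => hPb c τ h0 h1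
  -- the Mellin transforms along different lines agree
  have hshift : ∀ {t : ℝ}, 0 < t → ∀ c : ℝ, 0 ≤ c → c ≤ 1 →
      t ^ (θ - c) • 𝓕 (P c) (Real.log t / (2 * Real.pi)) =
        𝓕 (P θ) (Real.log t / (2 * Real.pi)) := by
    intro t ht c h0 h1
    set F : ℂ → X := fun z => (G z * Complex.exp (-(Real.log t) * (z - θ))) • f z with hF
    have hline : ∀ c : ℝ, ∫ τ : ℝ, F (c + τ * Complex.I) =
        t ^ (θ - c) • 𝓕 (P c) (Real.log t / (2 * Real.pi)) := by
      intro c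
      rw [Real.fourier_real_eq_integral_exp_smul, ← integral_smul]
      refine integral_congr_ae (Eventually.of_forall fun τ => ?_)
      have e : Complex.exp (-(Real.log t) * ((c : ℂ) + τ * Complex.I - θ)) =
          ((t ^ (θ - c) : ℝ) : ℂ) * Complex.exp
            (((-2 * Real.pi * τ * (Real.log t / (2 * Real.pi)) : ℝ) : ℂ) * Complex.I) := by
        rw [Real.rpow_def_of_pos ht, Complex.ofReal_exp, ← Complex.exp_add]
        congr 1
        have : (-2 * Real.pi * τ * (Real.log t / (2 * Real.pi)) : ℝ) = -(Real.log t * τ) := by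
          field_simp
        rw [this]
        push_cast
        ring
      simp only [hF, hP]
      rw [e, ← Complex.coe_smul, smul_smul, smul_smul]
      congr 1
      ring
    have hcF : ContinuousOn F {z : ℂ | 0 ≤ z.re ∧ z.re ≤ 1} :=
      ContinuousOn.smul (Continuous.continuousOn (by fun_prop)) hf.continuousOn
    have hdF : DifferentiableOn ℂ F {z : ℂ | 0 < z.re ∧ z.re < 1} :=
      DifferentiableOn.smul (Differentiable.differentiableOn (by fun_prop)) hf.holomorphic
    have hbF : ∀ c τ : ℝ, 0 ≤ c → c ≤ 1 →
        ‖F (c + τ * Complex.I)‖ ≤ (Real.exp |Real.log t| * (Real.exp 1 * C)) * Real.exp (-τ ^ 2) := by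
      intro c τ h0 h1
      have e1 : ‖Complex.exp (-(Real.log t) * ((c : ℂ) + τ * Complex.I - θ))‖ ≤
          Real.exp |Real.log t| := by
        rw [Complex.norm_exp]
        refine Real.exp_le_exp.2 ?_
        have : (-(Real.log t : ℂ) * ((c : ℂ) + τ * Complex.I - θ)).re = -(Real.log t * (c - θ)) := by
          simp
        rw [this]
        refine (neg_le_abs _).trans ?_
        rw [abs_mul]
        exact mul_le_of_le_one_right (abs_nonneg _) (abs_le.2 ⟨by linarith, by linarith⟩)
      have e2 : F (c + τ * Complex.I) =
          Complex.exp (-(Real.log t) * ((c : ℂ) + τ * Complex.I - θ)) • P c τ := by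
        simp only [hF, hP, smul_smul, mul_comm]
      rw [e2, norm_smul, mul_assoc]
      exact mul_le_mul e1 (hPb c τ h0 h1) (norm_nonneg _) (Real.exp_pos _).le
    have hθ : ∫ τ : ℝ, F (θ + τ * Complex.I) = 𝓕 (P θ) (Real.log t / (2 * Real.pi)) := by
      rw [hline θ, sub_self, Real.rpow_zero, one_smul]
    rw [← hline c, ← hθ]
    rcases le_total c θ with h | h
    · exact integral_vertical_line_eq hcF hdF hbF h0 h hθ1.le
    · exact (integral_vertical_line_eq hcF hdF hbF hθ0.le h h1).symm
  -- the boundary values on `Re z = 1`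
  set Q : ℝ → Y := fun τ => G (1 + τ * Complex.I) • g τ with hQ
  set q : ℝ → Y := fun τ => ((1 - θ : ℝ) + τ * Complex.I : ℂ)⁻¹ • Q τ with hq
  have hjQ : ∀ τ, j (Q τ) = P 1 τ := fun τ => by
    simp only [hQ, hP, map_smul, ← hg, Complex.ofReal_one]
  have hden : ∀ τ : ℝ, ((1 - θ : ℝ) + τ * Complex.I : ℂ) ≠ 0 := fun τ h => by
    have := congrArg Complex.re h
    simp at this
    linarith
  have hQc : Continuous Q := Continuous.smul (by fun_prop) g.continuous
  have hQb : ∀ τ, ‖Q τ‖ ≤ (Real.exp 1 * ‖g‖) * Real.exp (-τ ^ 2) := by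
    intro τ
    rw [hQ, norm_smul]
    have := hGb 1 τ zero_le_one le_rfl
    rw [Complex.ofReal_one] at this
    calc _ ≤ (Real.exp 1 * Real.exp (-τ ^ 2)) * ‖g‖ :=
          mul_le_mul this (g.norm_coe_le_norm τ) (norm_nonneg _) (by positivity)
      _ = _ := by ring
  have hqc : Continuous q := by
    refine Continuous.smul (Continuous.inv₀ (by fun_prop) hden) hQc
  have hqb : ∀ τ, ‖q τ‖ ≤ ((1 - θ)⁻¹ * (Real.exp 1 * ‖g‖)) * Real.exp (-τ ^ 2) := by
    intro τ
    rw [hq, norm_smul, mul_assoc]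
    refine mul_le_mul ?_ (hQb τ) (norm_nonneg _) (by
      have : 0 < 1 - θ := by linarith
      positivity)
    rw [norm_inv]
    refine inv_anti₀ (by linarith) ?_
    refine le_trans ?_ (Complex.re_le_norm _)
    simp
  have hdq : ∀ τ : ℝ, ((1 - θ : ℝ) + τ * Complex.I : ℂ) • q τ = Q τ := fun τ => by
    simp only [hq, smul_smul, mul_inv_cancel₀ (hden τ), one_smul]
  obtain ⟨hQi, -⟩ := integrable_of_gaussian hQc hQb
  obtain ⟨hqi, hq2⟩ := integrable_of_gaussian hqc hqb
  have hτq : Integrable fun τ : ℝ => τ • q τ := by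
    have hcont : Continuous fun τ : ℝ => τ • q τ := continuous_id.smul hqc
    refine hQi.norm.mono' hcont.aestronglyMeasurable (Eventually.of_forall fun τ => ?_)
    have hle := Complex.abs_im_le_norm ((1 - θ : ℝ) + τ * Complex.I : ℂ)
    calc ‖τ • q τ‖ = ‖τ‖ * ‖q τ‖ := norm_smul _ _
      _ ≤ ‖((1 - θ : ℝ) + τ * Complex.I : ℂ)‖ * ‖q τ‖ :=
        mul_le_mul_of_nonneg_right (by simpa using hle) (norm_nonneg _)
      _ = ‖Q τ‖ := by rw [← norm_smul, hdq τ]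
  -- `u` below is `(2π)⁻¹ t ^ (θ - 1) 𝓕 q (log t / 2π)`; this identity computes its derivative
  have hderiv : ∀ ξ, (θ - 1) • 𝓕 q ξ + (2 * Real.pi)⁻¹ •
      𝓕 (fun τ : ℝ => (-2 * Real.pi * Complex.I * τ) • q τ) ξ = -𝓕 Q ξ := by
    intro ξ
    have hτq' : Integrable fun τ : ℝ => (-2 * Real.pi * Complex.I * τ) • q τ := by
      refine (hτq.smul (-2 * Real.pi * Complex.I)).congr (Eventually.of_forall fun τ => ?_)
      simp only [Pi.smul_apply, ← Complex.coe_smul τ, smul_smul]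
    simp only [Real.fourier_real_eq_integral_exp_smul]
    rw [← integral_smul, ← integral_smul, ← integral_neg]
    refine (integral_add ((integrable_exp_smul hqi ξ).smul (θ - 1))
      ((integrable_exp_smul hτq' ξ).smul (2 * Real.pi)⁻¹)).symm.trans ?_
    refine integral_congr_ae (Eventually.of_forall fun τ => ?_)
    have hpi' : (Real.pi : ℂ) ≠ 0 := by exact_mod_cast Real.pi_ne_zero
    simp only [Pi.smul_apply, ← hdq τ, ← Complex.coe_smul, smul_smul, ← add_smul, ← neg_smul]
    congr 1
    push_cast
    field_simp
    ring
  set u : ℝ → Y := fun t =>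
    ((2 * Real.pi)⁻¹ * t ^ (θ - 1)) • 𝓕 q (Real.log t / (2 * Real.pi)) with hu
  set v : ℝ → X := fun t =>
    (-(2 * Real.pi)⁻¹ * t ^ (θ - 1)) • 𝓕 (P 0) (Real.log t / (2 * Real.pi)) with hv
  have mu : MemLp (powMul (1 - θ) u) 2 starMeasure := by
    refine ((memLp_comp_log (continuous_fourier_of_integrable hqi)
      (memLp_fourier hqi hq2)).const_smul ((2 * Real.pi)⁻¹ : ℝ)).ae_eq ?_
    refine ae_starMeasure_iff.2 ?_
    filter_upwards [ae_restrict_mem measurableSet_Ioi] with t ht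
    rw [powMul_eq_smul, hu, smul_smul, mul_left_comm, ← Real.rpow_add ht]
    simp
  have mv : MemLp (powMul (1 - θ) v) 2 starMeasure := by
    obtain ⟨hi, hi2⟩ := hPi 0 le_rfl zero_le_one
    refine ((memLp_comp_log (continuous_fourier_of_integrable hi)
      (hX _ hi hi2)).const_smul (-(2 * Real.pi)⁻¹ : ℝ)).ae_eq ?_
    refine ae_starMeasure_iff.2 ?_
    filter_upwards [ae_restrict_mem measurableSet_Ioi] with t ht
    rw [powMul_eq_smul, hv, smul_smul, mul_left_comm, ← Real.rpow_add ht]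
    simp
  -- the formula for `v` on the line `Re z = 0` is moved to the lines `Re z = θ` and `Re z = 1`
  have hvR := integrableOn_Ioc_of_memLp (by linarith) mv
  have hv2 : ∀ t : ℝ, 0 < t → v t =
      (-(2 * Real.pi)⁻¹) • t⁻¹ • 𝓕 (P θ) (Real.log t / (2 * Real.pi)) := by
    intro t ht
    rw [hv, ← hshift ht 0 le_rfl zero_le_one, smul_smul, smul_smul, sub_zero]
    simp only [Real.rpow_sub ht, Real.rpow_one]
    congr 1
    ring
  have hv1 : ∀ t : ℝ, 0 < t → v t =
      (-(2 * Real.pi)⁻¹ * t ^ (θ - 2)) • j (𝓕 Q (Real.log t / (2 * Real.pi))) := by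
    intro t ht
    rw [hv2 t ht, ← hshift ht 1 zero_le_one le_rfl, ← fourier_clm_comp j hQi, smul_smul, smul_smul]
    simp only [hjQ]
    congr 1
    rw [mul_assoc, ← Real.rpow_neg_one t, ← Real.rpow_add ht]
    ring_nf
  -- near `0` the weighted norm of `v` is used, near `∞` the decay `t ^ (θ - 2)` on `Re z = 1`
  have hvI : IntegrableOn v (Ioi 0) := by
    rw [← Ioc_union_Ioi_eq_Ioi zero_le_one]
    refine (hvR 1).union ?_
    refine Integrable.mono' (((integrableOn_Ioi_rpow_of_lt (a := θ - 2) (by linarith)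
      one_pos).const_mul ((2 * Real.pi)⁻¹ * (‖j‖ * ∫ τ, ‖Q τ‖))))
      ((aestronglyMeasurable_of_memLp_powMul mv).mono_measure
        (Measure.restrict_mono (Ioi_subset_Ioi zero_le_one) le_rfl)) ?_
    filter_upwards [ae_restrict_mem measurableSet_Ioi] with t ht
    have ht0 : 0 < t := zero_lt_one.trans ht
    have h1 : ‖j (𝓕 Q (Real.log t / (2 * Real.pi)))‖ ≤ ‖j‖ * ∫ τ, ‖Q τ‖ :=
      (j.le_opNorm _).trans (mul_le_mul_of_nonneg_left (norm_fourier_le _ _) (norm_nonneg _))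
    have h2 : 0 ≤ (2 * Real.pi)⁻¹ * t ^ (θ - 2) := by positivity
    rw [hv1 t ht0, norm_smul, neg_mul, norm_neg, Real.norm_of_nonneg h2]
    calc _ ≤ (2 * Real.pi)⁻¹ * t ^ (θ - 2) * (‖j‖ * ∫ τ, ‖Q τ‖) :=
          mul_le_mul_of_nonneg_left h1 h2
      _ = _ := by ring
  have hud : ∀ t : ℝ, 0 < t → HasDerivAt (fun t => j (u t)) (v t) t := by
    intro t ht
    have ha : HasDerivAt (fun t : ℝ => (2 * Real.pi)⁻¹ * t ^ (θ - 1))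
        ((2 * Real.pi)⁻¹ * ((θ - 1) * t ^ (θ - 1 - 1))) t :=
      (Real.hasDerivAt_rpow_const (Or.inl ht.ne')).const_mul _
    have hb := (Real.hasDerivAt_fourier hqi hτq (Real.log t / (2 * Real.pi))).scomp t
      ((Real.hasDerivAt_log ht.ne').div_const (2 * Real.pi))
    have hab := (j.restrictScalars ℝ).hasFDerivAt.comp_hasDerivAt t (ha.smul hb)
    refine hab.congr_deriv ?_
    change j _ = _
    have e0 : v t = j (((2 * Real.pi)⁻¹ * t ^ (θ - 2)) •
        ((θ - 1) • 𝓕 q (Real.log t / (2 * Real.pi)) + (2 * Real.pi)⁻¹ •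
          𝓕 (fun τ : ℝ => (-2 * Real.pi * Complex.I * τ) • q τ) (Real.log t / (2 * Real.pi)))) := by
      rw [hderiv, smul_neg, map_neg, ContinuousLinearMap.map_smul_of_tower, hv1 t ht, neg_mul,
        neg_smul]
    rw [e0]
    congr 1
    have e1 : θ - 1 - 1 = θ - 2 := by ring
    have e2 : t ^ (θ - 1) = t * t ^ (θ - 2) := by
      rw [← Real.rpow_one_add' ht.le (by linarith)]
      ring_nf
    rw [e1, smul_add, smul_smul, smul_smul, smul_smul, Function.comp_apply, add_comm, e2]
    congr 2
    · ring
    · field_simp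
  have hu0 : Tendsto (fun t => j (u t)) atTop (𝓝 0) := by
    have h1 : Tendsto (fun t : ℝ => ‖j‖ * ((2 * Real.pi)⁻¹ * t ^ (-(1 - θ)) * ∫ τ, ‖q τ‖))
        atTop (𝓝 0) := by
      have := tendsto_rpow_neg_atTop (y := 1 - θ) (by linarith)
      simpa using ((this.const_mul (2 * Real.pi)⁻¹).mul_const (∫ τ, ‖q τ‖)).const_mul ‖j‖
    refine squeeze_zero_norm' ?_ h1
    filter_upwards [eventually_gt_atTop 0] with t ht
    have h2 : 0 ≤ (2 * Real.pi)⁻¹ * t ^ (θ - 1) := by positivity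
    refine (j.le_opNorm _).trans (mul_le_mul_of_nonneg_left ?_ (norm_nonneg _))
    rw [hu, norm_smul, Real.norm_of_nonneg h2, neg_sub]
    exact mul_le_mul_of_nonneg_left (norm_fourier_le _ _) h2
  -- on `Re z = θ` the integral of `v` is a Fourier inversion, and `f θ = x`
  have hv0 : ∫ t in Ioi (0 : ℝ), v t = -x := by
    have h1 : ∫ t in Ioi (0 : ℝ), v t = ∫ t in Ioi (0 : ℝ),
        (-(2 * Real.pi)⁻¹) • t⁻¹ • 𝓕 (P θ) (Real.log t / (2 * Real.pi)) :=
      setIntegral_congr_fun measurableSet_Ioi hv2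
    have h2 : IntegrableOn (fun t => t⁻¹ • 𝓕 (P θ) (Real.log t / (2 * Real.pi))) (Ioi 0) := by
      refine (hvI.smul (-(2 * Real.pi))).congr ?_
      filter_upwards [ae_restrict_mem measurableSet_Ioi] with t ht
      rw [Pi.smul_apply, hv2 t ht, smul_smul, neg_mul_neg, mul_inv_cancel₀ hpi.ne', one_smul]
    rw [h1, integral_smul, integral_inv_smul_fourier_log (hPc θ hθ0.le hθ1.le)
      (hPi θ hθ0.le hθ1.le).1 h2, smul_smul, neg_mul, inv_mul_cancel₀ hpi.ne', neg_smul, one_smul]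
    simp [hP, hG, hfx]
  refine ⟨u, v, mu, mv, hvR, ?_⟩
  filter_upwards [ae_restrict_mem measurableSet_Ioi] with t ht
  have ht0 : (0 : ℝ) < t := ht
  have h1 : ∫ τ in Ioi t, v τ = 0 - j (u t) :=
    integral_Ioi_of_hasDerivAt_of_tendsto' (fun τ hτ => hud τ (ht0.trans_le hτ))
      (hvI.mono_set (Ioi_subset_Ioi ht0.le)) hu0
  have h2 : (∫ τ in (0 : ℝ)..t, v τ) + ∫ τ in Ioi t, v τ = ∫ τ in Ioi (0 : ℝ), v τ :=
    intervalIntegral.integral_interval_add_Ioi hvI (hvI.mono_set (Ioi_subset_Ioi ht0.le))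
  rw [hv0, h1] at h2
  have h3 : (∫ τ in (0 : ℝ)..t, v τ) = -x + j (u t) := by
    rw [zero_sub, ← sub_eq_add_neg, sub_eq_iff_eq_add] at h2
    exact h2
  rw [h3, add_neg_cancel_left]

/-- The substitution `z ↦ 1 - z` shows that `[X₀, X₁]_θ = [X₁, X₀]_{1-θ}`. -/
theorem mem_complexInterp_symm {X₀ X₁ Z : Type*}
    [NormedAddCommGroup X₀] [NormedSpace ℂ X₀] [NormedAddCommGroup X₁] [NormedSpace ℂ X₁]
    [NormedAddCommGroup Z] [NormedSpace ℂ Z] {i₀ : X₀ →L[ℂ] Z} {i₁ : X₁ →L[ℂ] Z} {θ : ℝ} {x : Z}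
    (hx : x ∈ complexInterp i₀ i₁ θ) : x ∈ complexInterp i₁ i₀ (1 - θ) := by
  obtain ⟨f, hf, hfx⟩ := hx
  obtain ⟨C, hC⟩ := hf.bounded
  obtain ⟨g₀, hg₀⟩ := hf.left
  obtain ⟨g₁, hg₁⟩ := hf.right
  refine ⟨fun z => f (1 - z), ⟨?_, ⟨C, fun z h0 h1 => hC _ (by simpa) (by simpa)⟩, ?_, ?_, ?_⟩, ?_⟩
  · exact hf.continuousOn.comp (by fun_prop) fun z hz => ⟨by simpa using hz.2, by simpa using hz.1⟩
  · exact hf.holomorphic.comp (by fun_prop) fun z hz => ⟨by simpa using hz.2, by simpa using hz.1⟩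
  · refine ⟨g₁.compContinuous ⟨fun t => -t, continuous_neg⟩, fun τ => ?_⟩
    rw [BoundedContinuousFunction.compContinuous_apply, ContinuousMap.coe_mk, ← hg₁]
    congr 1
    push_cast
    ring
  · refine ⟨g₀.compContinuous ⟨fun t => -t, continuous_neg⟩, fun τ => ?_⟩
    rw [BoundedContinuousFunction.compContinuous_apply, ContinuousMap.coe_mk, ← hg₀]
    congr 1
    push_cast
    ring
  · simpa using hfx

end Fourier

/-! ### The antidual of a Hilbert space -/

section Antidual

open scoped FourierTransform

variable (V : Type*) [NormedAddCommGroup V] [InnerProductSpace ℂ V] [CompleteSpace V]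

/-- The Riesz isomorphism `v ↦ (v | ·)_V` of a Hilbert space onto its antidual. -/
noncomputable def antidualEquiv : V ≃ₗᵢ[ℂ] (V →L⋆[ℂ] ℂ) :=
  LinearIsometryEquiv.ofSurjective
    { toLinearMap := (toAntidual (ContinuousLinearMap.id ℂ V)).toLinearMap
      norm_map' := fun v => by
        refine le_antisymm ?_ ?_
        · refine ContinuousLinearMap.opNorm_le_bound _ (norm_nonneg _) fun w => ?_
          exact (norm_inner_le_norm w v).trans (mul_comm _ _).le
        · rcases (norm_nonneg v).eq_or_lt with h | h
          · rw [← h]; exact norm_nonneg _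
          · refine le_of_mul_le_mul_right ?_ h
            have h1 := (toAntidual (ContinuousLinearMap.id ℂ V) v).le_opNorm v
            rw [toAntidual_apply, ContinuousLinearMap.id_apply, inner_self_eq_norm_sq_to_K] at h1
            simpa [sq] using h1 } fun w => by
    refine ⟨(InnerProductSpace.toDual ℂ V).symm
      ((starL ℂ : ℂ ≃L⋆[ℂ] ℂ).toContinuousLinearMap.comp w), ?_⟩
    ext v
    change inner ℂ v _ = w v
    rw [← inner_conj_symm, InnerProductSpace.toDual_symm_apply]
    simp

variable {V}

theorem antidualEquiv_apply (v w : V) : antidualEquiv V v w = inner ℂ w v := rfl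

theorem inner_antidualEquiv_symm (v : V) (w : V →L⋆[ℂ] ℂ) :
    inner ℂ v ((antidualEquiv V).symm w) = w v := by
  rw [← antidualEquiv_apply, LinearIsometryEquiv.apply_symm_apply]

theorem memLp_fourier_antidual {g : ℝ → V →L⋆[ℂ] ℂ} (hg : Integrable g) (hg2 : MemLp g 2) :
    MemLp (𝓕 g) 2 := by
  set R : (V →L⋆[ℂ] ℂ) →L[ℂ] V :=
    (antidualEquiv V).symm.toContinuousLinearEquiv.toContinuousLinearMap with hR
  set S : V →L[ℂ] (V →L⋆[ℂ] ℂ) :=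
    (antidualEquiv V).toContinuousLinearEquiv.toContinuousLinearMap with hS
  have h1 : Integrable fun τ => R (g τ) := R.integrable_comp hg
  have h := S.comp_memLp' (memLp_fourier h1 (R.comp_memLp' hg2))
  refine h.ae_eq (Eventually.of_forall fun ξ => ?_)
  simp only [Function.comp_apply]
  rw [← fourier_clm_comp S (by exact h1)]
  simp [hR, hS]

end Antidual

/-! ### The variational problem -/

section Variational

theorem memLp_powMul_of_hasCompactSupport {X : Type*} [NormedAddCommGroup X] [NormedSpace ℂ X]
    {a : ℝ} (ha : 0 < a) {f : ℝ → X} (hf : Continuous f) (hc : HasCompactSupport f) :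
    MemLp (powMul a f) 2 starMeasure := by
  obtain ⟨C, hC⟩ := hc.exists_bound_of_continuous hf
  obtain ⟨R, hR⟩ := hc.isCompact.bddAbove
  refine memLp_powMul_of_bounded ha hf.aestronglyMeasurable hC (R := R) fun t ht => ?_
  exact image_eq_zero_of_notMem_tsupport fun h => absurd (hR h) (not_le.2 ht)

/-- The Lax–Milgram theorem on a closed subspace. -/
theorem exists_mem_inner_eq_of_coercive {K : Type*} [NormedAddCommGroup K] [InnerProductSpace ℂ K]
    [CompleteSpace K] (W : Submodule ℂ K) (hW : IsClosed (W : Set K)) (T : K →L[ℂ] K) {c : ℝ}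
    (hc : 0 < c) (hT : ∀ k, c * ‖k‖ ^ 2 ≤ (inner ℂ (T k) k).re) (l : K) :
    ∃ w ∈ W, ∀ v ∈ W, inner ℂ v (T w) = inner ℂ v l := by
  have : CompleteSpace W := hW.completeSpace_coe
  set A : W →L[ℂ] W := ContinuousLinearMap.adjoint W.subtypeL ∘L T ∘L W.subtypeL with hA
  have hu : IsUnit A := by
    refine ContinuousLinearMap.isUnit_of_forall_le_norm_inner_map A (c := ⟨c, hc.le⟩) hc fun w => ?_
    rw [hA, ContinuousLinearMap.comp_apply, ContinuousLinearMap.adjoint_inner_left, mul_comm]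
    exact (hT w).trans (Complex.re_le_norm _)
  obtain ⟨U, hU⟩ := hu
  have h1 : ∀ v, A ((↑U⁻¹ : W →L[ℂ] W) v) = v := fun v => by
    rw [← hU]; exact congrArg (fun f : W →L[ℂ] W => f v) U.mul_inv
  set w : W := (↑U⁻¹ : W →L[ℂ] W) (ContinuousLinearMap.adjoint W.subtypeL l) with hw
  refine ⟨w, w.2, fun v hv => ?_⟩
  have h2 := congrArg (fun z : W => inner ℂ (⟨v, hv⟩ : W) z)
    (h1 (ContinuousLinearMap.adjoint W.subtypeL l))
  simp only [hA, ContinuousLinearMap.comp_apply, ContinuousLinearMap.adjoint_inner_right] at h2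
  exact h2

/-- A coercive operator acts pointwise as a coercive operator on `L²`. -/
theorem coercive_compLpL {α F : Type*} [MeasurableSpace α] {μ : Measure α} [NormedAddCommGroup F]
    [InnerProductSpace ℂ F] (A : F →L[ℂ] F) {c : ℝ}
    (hA : ∀ x, c * ‖x‖ ^ 2 ≤ (inner ℂ (A x) x).re) (k : Lp F 2 μ) :
    c * ‖k‖ ^ 2 ≤ (inner ℂ (A.compLpL 2 μ k) k).re := by
  have h1 : ‖k‖ ^ 2 = ∫ t, ‖k t‖ ^ 2 ∂μ := by
    have := inner_self_eq_norm_sq (𝕜 := ℂ) k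
    rw [← this, L2.inner_def, ← integral_re (L2.integrable_inner (𝕜 := ℂ) k k)]
    exact integral_congr_ae (Eventually.of_forall fun t =>
      (inner_self_eq_norm_sq (𝕜 := ℂ) (k t)).symm) |>.symm
  have h2 : (inner ℂ (A.compLpL 2 μ k) k).re = ∫ t, (inner ℂ (A.compLpL 2 μ k t) (k t)).re ∂μ := by
    rw [L2.inner_def]
    exact (integral_re (L2.integrable_inner (𝕜 := ℂ) (A.compLpL 2 μ k) k)).symm
  rw [h1, h2, ← integral_const_mul]
  refine integral_mono_ae ?_ (L2.integrable_inner (𝕜 := ℂ) (A.compLpL 2 μ k) k).re ?_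
  · exact ((memLp_two_iff_integrable_sq_norm (Lp.aestronglyMeasurable k)).1 (Lp.memLp k)).const_mul c
  · filter_upwards [A.coeFn_compLpL (p := 2) (μ := μ) k] with t ht
    rw [ht]
    exact hA (k t)

variable {V H : Type*} [NormedAddCommGroup V] [InnerProductSpace ℂ V]
  [NormedAddCommGroup H] [InnerProductSpace ℂ H]

theorem memLp_pair {α : Type*} [MeasurableSpace α] {μ : Measure α} {f : α → V} {g : α → H}
    (hf : MemLp f 2 μ) (hg : MemLp g 2 μ) : MemLp (fun t => WithLp.toLp 2 (f t, g t)) 2 μ := by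
  set e : (V × H) →L[ℂ] WithLp 2 (V × H) := 
    (WithLp.prodContinuousLinearEquiv 2 ℂ V H).symm.toContinuousLinearMap
  have h1 := (e.comp (ContinuousLinearMap.inl ℂ V H)).comp_memLp' hf
  have h2 := (e.comp (ContinuousLinearMap.inr ℂ V H)).comp_memLp' hg
  refine (h1.add h2).ae_eq (Eventually.of_forall fun t => ?_)
  simp only [Pi.add_apply, Function.comp_apply, ContinuousLinearMap.comp_apply, ← map_add]
  simp [e]

theorem inner_toLp_pair {α : Type*} [MeasurableSpace α] {μ : Measure α} {f f' : α → V} {g g' : α → H}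
    (hf : MemLp f 2 μ) (hg : MemLp g 2 μ) (hf' : MemLp f' 2 μ) (hg' : MemLp g' 2 μ) :
    inner ℂ ((memLp_pair hf hg).toLp _) ((memLp_pair hf' hg').toLp _) =
      ∫ t, (inner ℂ (f t) (f' t) + inner ℂ (g t) (g' t)) ∂μ := by
  rw [L2.inner_def]
  refine integral_congr_ae ?_
  filter_upwards [(memLp_pair hf hg).coeFn_toLp, (memLp_pair hf' hg').coeFn_toLp] with t h1 h2
  rw [h1, h2, WithLp.prod_inner_apply]

theorem ae_eq_powMul_powMul_neg {X : Type*} [NormedAddCommGroup X] [NormedSpace ℂ X] (a : ℝ)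
    (f : ℝ → X) : f =ᵐ[starMeasure] powMul a (powMul (-a) f) := by
  refine ae_starMeasure_iff.2 ?_
  filter_upwards [ae_restrict_mem measurableSet_Ioi] with t ht
  rw [powMul_powMul _ _ _ ht]
  simp [powMul]

/-- Every element of `L²(dt / t; V × H)` is of the form `t ^ a (u, u')`. -/
theorem exists_toLp_pair_eq (a : ℝ) (k : Lp (WithLp 2 (V × H)) 2 starMeasure) :
    ∃ (u : ℝ → V) (u' : ℝ → H) (hu : MemLp (powMul a u) 2 starMeasure)
      (hu' : MemLp (powMul a u') 2 starMeasure), (memLp_pair hu hu').toLp _ = k := by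
  set e : WithLp 2 (V × H) →L[ℂ] V × H :=
    (WithLp.prodContinuousLinearEquiv 2 ℂ V H).toContinuousLinearMap
  have h1 := ((ContinuousLinearMap.fst ℂ V H).comp e).comp_memLp' (Lp.memLp k)
  have h2 := ((ContinuousLinearMap.snd ℂ V H).comp e).comp_memLp' (Lp.memLp k)
  refine ⟨powMul (-a) fun t => (k t).fst, powMul (-a) fun t => (k t).snd,
    h1.ae_eq (ae_eq_powMul_powMul_neg a _), h2.ae_eq (ae_eq_powMul_powMul_neg a _), ?_⟩
  refine Lp.ext ((MemLp.coeFn_toLp _).trans ?_)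
  filter_upwards [ae_eq_powMul_powMul_neg a fun t => (k t).fst,
    ae_eq_powMul_powMul_neg a fun t => (k t).snd] with t e1 e2
  rw [← e1, ← e2]
  rfl

theorem memLp_powMul_star_smul {X : Type*} [NormedAddCommGroup X] [NormedSpace ℂ X] {a : ℝ}
    (ha : 0 < a) {φ : ℝ → ℂ} (hφ : Continuous φ) (hc : HasCompactSupport φ) (x : X) :
    MemLp (powMul a fun t => star (φ t) • x) 2 starMeasure :=
  memLp_powMul_of_hasCompactSupport ha (hφ.star.smul continuous_const)
    (hc.comp_left (g := star) (star_zero ℂ)).smul_right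

theorem isPrimitive_star_smul {X : Type*} [NormedAddCommGroup X] [NormedSpace ℂ X]
    [CompleteSpace X] {φ : ℝ → ℂ} (hφ : ContDiff ℝ 1 φ) (x : X) :
    IsPrimitive (star (φ 0) • x) (fun t => star (φ t) • x) fun t => star (deriv φ t) • x := by
  have hc : Continuous fun t => star (deriv φ t) • x :=
    (hφ.continuous_deriv le_rfl).star.smul continuous_const
  refine ⟨fun R => hc.continuousOn.integrableOn_Icc.mono_set Ioc_subset_Icc_self,
    Eventually.of_forall fun t => ?_⟩
  rw [intervalIntegral.integral_eq_sub_of_hasDerivAt (f := fun t => star (φ t) • x)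
    (fun τ _ => ((hφ.differentiable (by simp) τ).hasDerivAt.star).smul_const x)
    (hc.intervalIntegrable _ _)]
  simp

variable [CompleteSpace V]

/-- Testing with the pair `(φ̄ η, φ̄' ι η)`. -/
theorem inner_toLp_tensor (ι : V →L[ℂ] H) {s : ℝ} (hs : s < 1) {l₁ : ℝ → V →L⋆[ℂ] ℂ}
    {l₂ : ℝ → H} (m₁ : MemLp (powMul s l₁) 2 starMeasure) (m₂ : MemLp (powMul s l₂) 2 starMeasure)
    {φ : ℝ → ℂ} (hφ : ContDiff ℝ ∞ φ) (hc : HasCompactSupport φ) (η : V)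
    (m : MemLp (powMul (1 - s) fun t => star (φ t) • η) 2 starMeasure)
    (m' : MemLp (powMul (1 - s) fun t => star (deriv φ t) • ι η) 2 starMeasure)
    {k : Lp (WithLp 2 (V × H)) 2 starMeasure}
    (hk : ∀ᵐ t ∂volume.restrict (Ioi (0 : ℝ)),
      k t = WithLp.toLp 2 ((antidualEquiv V).symm (powMul s l₁ t), powMul s l₂ t)) :
    inner ℂ ((memLp_pair m m').toLp _) k =
      ((∫ t in Ioi (0 : ℝ), φ t • l₁ t) +
        ∫ t in Ioi (0 : ℝ), deriv φ t • toAntidual ι (l₂ t)) η := by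
  have mφ : MemLp (powMul (1 - s) φ) 2 starMeasure :=
    memLp_powMul_of_hasCompactSupport (by linarith) hφ.continuous hc
  have mφ' : MemLp (powMul (1 - s) (deriv φ)) 2 starMeasure :=
    memLp_powMul_of_hasCompactSupport (by linarith) (hφ.continuous_deriv (by simp)) hc.deriv
  have mιl : MemLp (powMul s fun t => toAntidual ι (l₂ t)) 2 starMeasure :=
    memLp_powMul_clm (toAntidual ι) m₂
  have j1 : IntegrableOn (fun t => φ t • l₁ t) (Ioi 0) :=
    integrableOn_bilin (ContinuousLinearMap.lsmul ℝ ℂ :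
      ℂ →L[ℝ] (V →L⋆[ℂ] ℂ) →L[ℝ] (V →L⋆[ℂ] ℂ)).flip m₁ mφ
  have j2 : IntegrableOn (fun t => deriv φ t • toAntidual ι (l₂ t)) (Ioi 0) :=
    integrableOn_bilin (ContinuousLinearMap.lsmul ℝ ℂ :
      ℂ →L[ℝ] (V →L⋆[ℂ] ℂ) →L[ℝ] (V →L⋆[ℂ] ℂ)).flip mιl mφ'
  have e1 := integral_bilin_starMeasure (pairing V) s l₁ (fun t => star (φ t) • η)
  have e2 := integral_bilin_starMeasure (innerPairing H) s l₂ (fun t => star (deriv φ t) • ι η)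
  have k1 := memLp_one_iff_integrable.1 ((pairing V).memLp_of_bilin 1 m₁ m)
  have k2 := memLp_one_iff_integrable.1 ((innerPairing H).memLp_of_bilin 1 m₂ m')
  have h1 : inner ℂ ((memLp_pair m m').toLp _) k =
      ∫ t, (pairing V (powMul s l₁ t) (powMul (1 - s) (fun t => star (φ t) • η) t) +
        innerPairing H (powMul s l₂ t) (powMul (1 - s) (fun t => star (deriv φ t) • ι η) t))
        ∂starMeasure := by
    rw [L2.inner_def]
    refine integral_congr_ae ?_
    filter_upwards [(memLp_pair m m').coeFn_toLp, ae_starMeasure_iff.2 hk] with t h1 h2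
    rw [h1, h2, WithLp.prod_inner_apply]
    simp only [inner_antidualEquiv_symm, pairing_apply, innerPairing_apply]
  rw [h1, integral_add k1 k2, e1, e2]
  rw [← pairing_apply, ← ContinuousLinearMap.flip_apply, map_add, ← ContinuousLinearMap.integral_comp_comm _ j1,
    ← ContinuousLinearMap.integral_comp_comm _ j2]
  simp [pairing_apply, innerPairing_apply, toAntidual_apply, mul_comm]

variable [CompleteSpace H]

/-- Testing a pair `(u, u')` against `(φ' ι* h, φ h)` expresses that `u'` is the weak derivative of
`ι u`. -/
theorem inner_toLp_test (ι : V →L[ℂ] H) {s : ℝ} (hs : 0 < s) {u : ℝ → V} {u' : ℝ → H}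
    (mu : MemLp (powMul (1 - s) u) 2 starMeasure) (mu' : MemLp (powMul (1 - s) u') 2 starMeasure)
    {φ : ℝ → ℂ} (hφ : ContDiff ℝ ∞ φ) (hc : HasCompactSupport φ) (h : H)
    (m : MemLp (powMul s fun t => star (deriv φ t) • ContinuousLinearMap.adjoint ι h) 2 starMeasure)
    (m' : MemLp (powMul s fun t => star (φ t) • h) 2 starMeasure) :
    inner ℂ ((memLp_pair m m').toLp _) ((memLp_pair mu mu').toLp _) =
      inner ℂ h ((∫ t in Ioi (0 : ℝ), deriv φ t • ι (u t)) + ∫ t in Ioi (0 : ℝ), φ t • u' t) := by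
  have i1 := integrableOn_bilin (innerPairing V).flip m mu
  have i2 := integrableOn_bilin (innerPairing H).flip m' mu'
  have mφ : MemLp (powMul s φ) 2 starMeasure :=
    memLp_powMul_of_hasCompactSupport hs hφ.continuous hc
  have mφ' : MemLp (powMul s (deriv φ)) 2 starMeasure :=
    memLp_powMul_of_hasCompactSupport hs (hφ.continuous_deriv (by simp)) hc.deriv
  have mιu : MemLp (powMul (1 - s) fun t => ι (u t)) 2 starMeasure := memLp_powMul_clm ι mu
  have j1 : IntegrableOn (fun t => deriv φ t • ι (u t)) (Ioi 0) :=
    integrableOn_bilin (ContinuousLinearMap.lsmul ℝ ℂ : ℂ →L[ℝ] H →L[ℝ] H) mφ' mιu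
  have j2 : IntegrableOn (fun t => φ t • u' t) (Ioi 0) :=
    integrableOn_bilin (ContinuousLinearMap.lsmul ℝ ℂ : ℂ →L[ℝ] H →L[ℝ] H) mφ mu'
  have e1 := integral_bilin_starMeasure (innerPairing V).flip s
    (fun t => star (deriv φ t) • ContinuousLinearMap.adjoint ι h) u
  have e2 := integral_bilin_starMeasure (innerPairing H).flip s (fun t => star (φ t) • h) u'
  have k1 := memLp_one_iff_integrable.1 ((innerPairing V).flip.memLp_of_bilin 1 m mu)
  have k2 := memLp_one_iff_integrable.1 ((innerPairing H).flip.memLp_of_bilin 1 m' mu')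
  rw [inner_toLp_pair m m' mu mu', inner_add_right, ← integral_inner j1, ← integral_inner j2]
  refine (integral_add k1 k2).trans ?_
  rw [e1, e2]
  simp only [ContinuousLinearMap.flip_apply, innerPairing_apply, inner_smul_left, inner_smul_right,
    ContinuousLinearMap.adjoint_inner_left, starRingEnd_apply, star_star]

/-- The variational problem; it is the equation `-(t ^ (1 - 2 s) u')' + t ^ (1 - 2 s) 𝒜 u = l₁ - l₂'`
with a boundary condition at `0` that is prescribed by `T`. Among the pairs `(u, u')` such that `u'` is the weak derivative of
`ι u` when tested with the functions in `T`, there is one at which the form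
`∫ t ^ (1 - 2 s) (E (u, v) + (u' | v')) dt` represents the functional
`v ↦ ∫ (⟨l₁, v⟩ + (l₂ | v')) dt`. Inserting `v = φ̄ η` yields the stated equation in `V'`. -/
theorem exists_variational_solution (ι : V →L[ℂ] H) (E : V →L[ℂ] (V →L⋆[ℂ] ℂ)) {μ : ℝ}
    (hμ : 0 < μ) (hE : ∀ u : V, μ * ‖u‖ ^ 2 ≤ (E u u).re) {s : ℝ} (hs₀ : 0 < s) (hs₁ : s < 1)
    (T : (ℝ → ℂ) → Prop) {l₁ : ℝ → V →L⋆[ℂ] ℂ} {l₂ : ℝ → H}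
    (m₁ : MemLp (powMul s l₁) 2 starMeasure) (m₂ : MemLp (powMul s l₂) 2 starMeasure) :
    ∃ (u : ℝ → V) (u' : ℝ → H), MemLp (powMul (1 - s) u) 2 starMeasure ∧
      MemLp (powMul (1 - s) u') 2 starMeasure ∧
      (∀ φ, ContDiff ℝ ∞ φ → HasCompactSupport φ → T φ →
        (∫ t in Ioi (0 : ℝ), deriv φ t • ι (u t)) + ∫ t in Ioi (0 : ℝ), φ t • u' t = 0) ∧
      ∀ φ : ℝ → ℂ, ContDiff ℝ ∞ φ → HasCompactSupport φ →
        (∀ ψ : ℝ → ℂ, T ψ → ψ 0 * φ 0 = 0) →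
        (∫ t in Ioi (0 : ℝ), φ t • powMul (1 - 2 * s) (fun τ => E (u τ)) t) +
          ∫ t in Ioi (0 : ℝ), deriv φ t • toAntidual ι (powMul (1 - 2 * s) u' t) =
        (∫ t in Ioi (0 : ℝ), φ t • l₁ t) +
          ∫ t in Ioi (0 : ℝ), deriv φ t • toAntidual ι (l₂ t) := by
  -- the operator of the form `E (u, v) + (u' | v')` on the Hilbert space `V × H`
  set A₁ : V × H →L[ℂ] V × H := ContinuousLinearMap.prodMap
    ((antidualEquiv V).symm.toContinuousLinearEquiv.toContinuousLinearMap ∘L E)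
    (ContinuousLinearMap.id ℂ H) with hA₁
  set A : WithLp 2 (V × H) →L[ℂ] WithLp 2 (V × H) :=
    (WithLp.prodContinuousLinearEquiv 2 ℂ V H).symm.toContinuousLinearMap ∘L A₁ ∘L
      (WithLp.prodContinuousLinearEquiv 2 ℂ V H).toContinuousLinearMap with hA
  have hAapp : ∀ (v : V) (h : H), A (WithLp.toLp 2 (v, h)) =
      WithLp.toLp 2 ((antidualEquiv V).symm (E v), h) := fun v h => rfl
  have hAc : ∀ k, min μ 1 * ‖k‖ ^ 2 ≤ (inner ℂ (A k) k).re := by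
    intro k
    obtain ⟨⟨v, h⟩, rfl⟩ : ∃ p : V × H, WithLp.toLp 2 p = k := ⟨k.ofLp, rfl⟩
    rw [hAapp, WithLp.prod_inner_apply, WithLp.prod_norm_sq_eq_of_L2, Complex.add_re]
    have e1 : (inner ℂ ((antidualEquiv V).symm (E v)) v).re = (E v v).re := by
      rw [← inner_antidualEquiv_symm, ← inner_conj_symm, Complex.conj_re]
    have e2 : (inner ℂ h h : ℂ).re = ‖h‖ ^ 2 := inner_self_eq_norm_sq (𝕜 := ℂ) h
    simp only [e1, e2]
    rw [mul_add]
    refine add_le_add ((mul_le_mul_of_nonneg_right (min_le_left _ _) (sq_nonneg _)).trans (hE v)) ?_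
    exact mul_le_of_le_one_left (sq_nonneg _) (min_le_right _ _)
  have memS : ∀ φ : ℝ → ℂ, ContDiff ℝ ∞ φ → HasCompactSupport φ → ∀ h : H,
      MemLp (powMul s fun t => star (deriv φ t) • ContinuousLinearMap.adjoint ι h) 2 starMeasure ∧
      MemLp (powMul s fun t => star (φ t) • h) 2 starMeasure := fun φ hφ hc h =>
    ⟨memLp_powMul_star_smul hs₀ (hφ.continuous_deriv (by simp)) hc.deriv _,
      memLp_powMul_star_smul hs₀ hφ.continuous hc _⟩
  -- after multiplication by `t ^ (1 - s)`, the admissible pairs are the elements of `L²(dt / t)`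
  -- that are orthogonal to the pairs `t ^ s (φ̄' ι* h, φ̄ h)`
  set S : Set (Lp (WithLp 2 (V × H)) 2 starMeasure) :=
    {z | ∃ (φ : ℝ → ℂ) (hφ : ContDiff ℝ ∞ φ) (hc : HasCompactSupport φ) (h : H), T φ ∧
      z = (memLp_pair (memS φ hφ hc h).1 (memS φ hφ hc h).2).toLp _} with hS
  set W : Submodule ℂ (Lp (WithLp 2 (V × H)) 2 starMeasure) := (Submodule.span ℂ S)ᗮ with hW
  have hWmem : ∀ k, k ∈ W ↔ ∀ z ∈ S, inner ℂ z k = 0 := fun k => by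
    refine ⟨fun hk z hz => hk z (Submodule.subset_span hz), fun hk z hz => ?_⟩
    have hle : Submodule.span ℂ S ≤ (ℂ ∙ k)ᗮ := Submodule.span_le.2 fun z hz =>
      Submodule.mem_orthogonal_singleton_iff_inner_left.2 (hk z hz)
    exact Submodule.mem_orthogonal_singleton_iff_inner_left.1 (hle hz)
  have ml₁ := (antidualEquiv V).symm.toContinuousLinearEquiv.toContinuousLinearMap.comp_memLp' m₁
  obtain ⟨k, hkW, hk⟩ := exists_mem_inner_eq_of_coercive W (Submodule.isClosed_orthogonal _)
    (A.compLpL 2 starMeasure) (lt_min hμ one_pos) (coercive_compLpL A hAc)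
    ((memLp_pair ml₁ m₂).toLp _)
  obtain ⟨u, u', mu, mu', rfl⟩ := exists_toLp_pair_eq (1 - s) k
  refine ⟨u, u', mu, mu', fun φ hφ hc hT => ?_, fun φ hφ hc h0 => ?_⟩
  · refine ext_inner_left ℂ fun h => ?_
    rw [inner_zero_right, ← inner_toLp_test ι hs₀ mu mu' hφ hc h (memS φ hφ hc h).1
      (memS φ hφ hc h).2]
    exact (hWmem _).1 hkW _ ⟨φ, hφ, hc, h, hT, rfl⟩
  · ext η
    have m : MemLp (powMul (1 - s) fun t => star (φ t) • η) 2 starMeasure :=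
      memLp_powMul_star_smul (by linarith) hφ.continuous hc _
    have m' : MemLp (powMul (1 - s) fun t => star (deriv φ t) • ι η) 2 starMeasure :=
      memLp_powMul_star_smul (by linarith) (hφ.continuous_deriv (by simp)) hc.deriv _
    -- `φ̄ η` is admissible: the boundary term `ψ 0 * star (φ 0)` of the weak derivative vanishes
    have hv : (memLp_pair m m').toLp _ ∈ W := by
      rw [hWmem]
      rintro z ⟨ψ, hψ, hψc, h, hψT, rfl⟩
      rw [inner_toLp_test ι hs₀ m m' hψ hψc h (memS ψ hψ hψc h).1 (memS ψ hψ hψc h).2]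
      simp only [map_smul]
      rw [(isPrimitive_star_smul (hφ.of_le (by simp)) (ι η)).integral_deriv_smul hψ hψc,
        sub_add_cancel, smul_smul]
      have : ψ 0 * star (φ 0) = 0 := by
        rcases mul_eq_zero.1 (h0 ψ hψT) with h1 | h1 <;> simp [h1]
      rw [this, zero_smul, neg_zero, inner_zero_right]
    have hv' := hk _ hv
    have m₁' : MemLp (powMul s (powMul (1 - 2 * s) fun τ => E (u τ))) 2 starMeasure :=
      (memLp_powMul_powMul_iff (by ring)).2 (memLp_powMul_clm E mu)
    have m₂' : MemLp (powMul s (powMul (1 - 2 * s) u')) 2 starMeasure :=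
      (memLp_powMul_powMul_iff (by ring)).2 mu'
    rw [inner_toLp_tensor ι hs₁ m₁' m₂' hφ hc η m m' ?_,
      inner_toLp_tensor ι hs₁ m₁ m₂ hφ hc η m m' ?_] at hv'
    · exact hv'
    · exact ae_starMeasure_iff.1 (MemLp.coeFn_toLp _)
    · filter_upwards [ae_starMeasure_iff.1 (A.coeFn_compLpL (p := 2) (μ := starMeasure)
        ((memLp_pair mu mu').toLp _)), ae_starMeasure_iff.1 (memLp_pair mu mu').coeFn_toLp,
        ae_restrict_mem measurableSet_Ioi] with t h1 h2 ht
      rw [h1, h2, hAapp, powMul_powMul _ _ _ ht, powMul_powMul _ _ _ ht,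
        show s + (1 - 2 * s) = 1 - s by ring]
      simp [powMul]

end Variational

/-! ### Solutions of the equation with their initial data -/

section Harmonic

variable {V H : Type*} [NormedAddCommGroup V] [InnerProductSpace ℂ V]
  [NormedAddCommGroup H] [InnerProductSpace ℂ H]

/-- An `s`-harmonic function `u` with derivative `u'` and initial data `x = u(0)` and
`y = lim t ^ (1 - 2 s) u'(t)`, with both derivatives expressed by primitives that start at `0`. -/
structure IsHarmonicPair (ι : V →L[ℂ] H) (E : V →L[ℂ] (V →L⋆[ℂ] ℂ)) (s : ℝ) (x : H)
    (y : V →L⋆[ℂ] ℂ) (u : ℝ → V) (u' : ℝ → H) : Prop where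
  memLp : MemLp (powMul (1 - s) u) 2 starMeasure
  memLp_deriv : MemLp (powMul (1 - s) u') 2 starMeasure
  primitive : IsPrimitive x (fun t => ι (u t)) u'
  conormal : IsPrimitive y (fun t => toAntidual ι (powMul (1 - 2 * s) u' t))
    (powMul (1 - 2 * s) fun τ => E (u τ))

variable {ι : V →L[ℂ] H} {E : V →L[ℂ] (V →L⋆[ℂ] ℂ)} {s : ℝ} {x : H} {y : V →L⋆[ℂ] ℂ}
  {u : ℝ → V} {u' : ℝ → H}

theorem memLp_powMul_form (E : V →L[ℂ] (V →L⋆[ℂ] ℂ))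
    (mu : MemLp (powMul (1 - s) u) 2 starMeasure) :
    MemLp (powMul s (powMul (1 - 2 * s) fun τ => E (u τ))) 2 starMeasure :=
  (memLp_powMul_powMul_iff (by ring)).2 (memLp_powMul_clm E mu)

theorem memLp_powMul_conormal (mu' : MemLp (powMul (1 - s) u') 2 starMeasure) :
    MemLp (powMul s (powMul (1 - 2 * s) u')) 2 starMeasure :=
  (memLp_powMul_powMul_iff (by ring)).2 mu'

theorem IsHarmonicPair.congr (h : IsHarmonicPair ι E s x y u u') {v : ℝ → V}
    (huv : u =ᵐ[volume.restrict (Ioi 0)] v) : IsHarmonicPair ι E s x y v u' where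
  memLp := memLp_powMul_congr h.memLp huv
  memLp_deriv := h.memLp_deriv
  primitive := h.primitive.congr (by filter_upwards [huv] with t ht; rw [ht]) EventuallyEq.rfl
  conormal := h.conormal.congr EventuallyEq.rfl
    (powMul_congr (by filter_upwards [huv] with t ht; rw [ht]))

theorem IsHarmonicPair.sub [CompleteSpace V] [CompleteSpace H]
    (h : IsHarmonicPair ι E s x y u u') {x₂ : H} {y₂ : V →L⋆[ℂ] ℂ}
    {v : ℝ → V} {v' : ℝ → H} (h₂ : IsHarmonicPair ι E s x₂ y₂ v v') :
    IsHarmonicPair ι E s (x - x₂) (y - y₂) (fun t => u t - v t) (fun t => u' t - v' t) where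
  memLp := memLp_powMul_sub h.memLp h₂.memLp
  memLp_deriv := memLp_powMul_sub h.memLp_deriv h₂.memLp_deriv
  primitive := (h.primitive.sub h₂.primitive).congr (Eventually.of_forall fun t => by simp)
    EventuallyEq.rfl
  conormal := (h.conormal.sub h₂.conormal).congr
    (Eventually.of_forall fun t => by simp [powMul, smul_sub])
    (Eventually.of_forall fun t => by simp [powMul, smul_sub])

theorem IsHarmonicPair.isHarmonic [CompleteSpace V] [CompleteSpace H] (hs₀ : 0 < s) (hs₁ : s < 1)
    (h : IsHarmonicPair ι E s x y u u') : IsHarmonic ι E s u where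
  memW :=
    { loc := locallyIntegrableOn_of_memLp (by linarith) h.memLp
      memLp := h.memLp
      deriv_memLp := ⟨u', h.primitive.isWeakDeriv, h.memLp_deriv⟩ }
  equation :=
    ⟨u', _, h.primitive.isWeakDeriv,
      { loc := locallyIntegrableOn_of_memLp hs₁ (memLp_powMul_conormal h.memLp_deriv)
        memLp := memLp_powMul_conormal h.memLp_deriv
        deriv_memLp := ⟨_, h.conormal.isWeakDeriv, memLp_powMul_form E h.memLp⟩ },
      h.conormal.isWeakDeriv, Eventually.of_forall fun _ => neg_add_cancel _⟩

theorem IsHarmonicPair.hasNormalDeriv [CompleteSpace V] [CompleteSpace H]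
    (h : IsHarmonicPair ι E s x y u u') : HasNormalDeriv ι s u (-y) :=
  ⟨u', h.primitive.isWeakDeriv,
    (h.conormal.comp_clm (-ContinuousLinearMap.id ℝ (V →L⋆[ℂ] ℂ))).hasTrace⟩

/-- The initial data of an `s`-harmonic function exist, since the weighted integrability makes both
derivatives integrable up to `0`. -/
theorem IsHarmonic.exists_isHarmonicPair [CompleteSpace V] [CompleteSpace H]
    (hs₀ : 0 < s) (hs₁ : s < 1)
    (h : IsHarmonic ι E s u) : ∃ u' x y, IsHarmonicPair ι E s x y u u' := by
  obtain ⟨v', hv', mv'⟩ := h.memW.deriv_memLp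
  obtain ⟨u', w', hu', hw, hw', heq⟩ := h.equation
  have mu' : MemLp (powMul (1 - s) u') 2 starMeasure :=
    memLp_powMul_congr mv' (hv'.ae_unique hu')
  have hwE : w' =ᵐ[volume.restrict (Ioi 0)] powMul (1 - 2 * s) fun τ => E (u τ) := by
    filter_upwards [heq] with t ht
    exact neg_add_eq_zero.1 ht
  obtain ⟨x, hx⟩ := hu'.exists_isPrimitive (integrableOn_Ioc_of_memLp (by linarith) mu')
  obtain ⟨y, hy⟩ := (hw'.congr EventuallyEq.rfl hwE).exists_isPrimitive
    (integrableOn_Ioc_of_memLp hs₁ (memLp_powMul_form E h.memW.memLp))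
  exact ⟨u', x, y, h.memW.memLp, mu', hx, hy⟩

/-- The normal derivative does not depend on the representative of the weak derivative. -/
theorem IsHarmonicPair.eq_of_hasNormalDeriv [CompleteSpace V] [CompleteSpace H]
    (h : IsHarmonicPair ι E s x y u u') {y₂ : V →L⋆[ℂ] ℂ} (hn : HasNormalDeriv ι s u y₂) :
    y = -y₂ := by
  obtain ⟨v', hv', ht⟩ := hn
  have e := powMul_congr (a := 1 - 2 * s) (h.primitive.isWeakDeriv.ae_unique hv')
  have h1 := (h.conormal.comp_clm (-ContinuousLinearMap.id ℝ (V →L⋆[ℂ] ℂ))).congr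
    (u₂ := fun t => -toAntidual ι (powMul (1 - 2 * s) v' t))
    (by filter_upwards [e] with t ht; simp [ht]) EventuallyEq.rfl
  have h2 := h1.eq_of_hasTrace ht
  rw [h2]
  simp

/-- An `s`-harmonic function one of whose initial data vanishes is zero: its energy is zero. -/
theorem IsHarmonicPair.ae_eq_zero [CompleteSpace V] [CompleteSpace H]
    (hι : Function.Injective ι) (hd : DenseRange ι)
    {μ : ℝ} (hμ : 0 < μ) (hE : ∀ u : V, μ * ‖u‖ ^ 2 ≤ (E u u).re)
    (h : IsHarmonicPair ι E s x y u u') (hxy : x = 0 ∨ y = 0) :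
    u =ᵐ[volume.restrict (Ioi 0)] 0 := by
  have mw := memLp_powMul_conormal h.memLp_deriv
  have mw' := memLp_powMul_form E h.memLp
  have h0 := integral_energy_eq_zero ι hι hd h.primitive h.conormal hxy h.memLp h.memLp_deriv mw mw'
  have i1 := integrableOn_bilin (pairing V) mw' h.memLp
  have i2 := integrableOn_bilin (innerPairing H) mw h.memLp_deriv
  have hi := i1.add i2
  have hre : ∀ t ∈ Ioi (0 : ℝ), t ^ (1 - 2 * s) * (μ * ‖u t‖ ^ 2) ≤
      (powMul (1 - 2 * s) (fun τ => E (u τ)) t (u t) +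
        inner ℂ (u' t) (powMul (1 - 2 * s) u' t)).re := fun t ht => by
    have ht' : 0 ≤ t ^ (1 - 2 * s) := Real.rpow_nonneg (le_of_lt ht) _
    have e1 : (inner ℂ (u' t) (u' t) : ℂ).re = ‖u' t‖ ^ 2 := inner_self_eq_norm_sq (𝕜 := ℂ) _
    simp only [powMul, inner_smul_right, smul_apply, smul_eq_mul, Complex.add_re,
      Complex.re_ofReal_mul, e1]
    nlinarith [mul_le_mul_of_nonneg_left (hE (u t)) ht', mul_nonneg ht' (sq_nonneg ‖u' t‖)]
  have hz : ∫ t in Ioi (0 : ℝ), (powMul (1 - 2 * s) (fun τ => E (u τ)) t (u t) +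
      inner ℂ (u' t) (powMul (1 - 2 * s) u' t)).re = 0 := by
    have := integral_re (𝕜 := ℂ) hi
    refine this.trans ?_
    exact (congrArg Complex.re h0)
  have hpos : ∀ t ∈ Ioi (0 : ℝ), 0 ≤ t ^ (1 - 2 * s) * (μ * ‖u t‖ ^ 2) := fun t ht =>
    mul_nonneg (Real.rpow_nonneg (le_of_lt ht) _) (by positivity)
  rw [setIntegral_eq_zero_iff_of_nonneg_ae ((ae_restrict_iff' measurableSet_Ioi).2
    (Eventually.of_forall fun t ht => (hpos t ht).trans (hre t ht))) hi.re] at hz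
  filter_upwards [hz, ae_restrict_mem measurableSet_Ioi] with t ht ht0
  have h1 := hre t ht0
  rw [ht] at h1
  have h2 : t ^ (1 - 2 * s) * (μ * ‖u t‖ ^ 2) = 0 := le_antisymm h1 (hpos t ht0)
  have h3 : 0 < t ^ (1 - 2 * s) := Real.rpow_pos_of_pos ht0 _
  simpa [h3.ne', hμ.ne'] using h2

theorem isWeakDeriv_of_forall_test {X : Type*} [NormedAddCommGroup X] [NormedSpace ℂ X] {a b : ℝ}
    (ha : a < 1) (hb : b < 1) {f g : ℝ → X} (hf : MemLp (powMul a f) 2 starMeasure)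
    (hg : MemLp (powMul b g) 2 starMeasure)
    (h : ∀ φ : ℝ → ℂ, ContDiff ℝ ∞ φ → HasCompactSupport φ → tsupport φ ⊆ Ioi 0 →
      (∫ t in Ioi (0 : ℝ), deriv φ t • f t) + ∫ t in Ioi (0 : ℝ), φ t • g t = 0) :
    IsWeakDeriv f g :=
  ⟨locallyIntegrableOn_of_memLp ha hf, locallyIntegrableOn_of_memLp hb hg,
    fun φ hφ hc hs => neg_eq_iff_add_eq_zero.2 (h φ hφ hc hs)⟩

/-- The equation tested with functions that vanish near `0` suffices: the initial value `y` then
exists automatically. -/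
theorem exists_isHarmonicPair_of_forall_test (hs₁ : s < 1)
    (mu : MemLp (powMul (1 - s) u) 2 starMeasure) (mu' : MemLp (powMul (1 - s) u') 2 starMeasure)
    (pu : IsPrimitive x (fun t => ι (u t)) u')
    (h : ∀ φ : ℝ → ℂ, ContDiff ℝ ∞ φ → HasCompactSupport φ → tsupport φ ⊆ Ioi 0 →
      (∫ t in Ioi (0 : ℝ), φ t • powMul (1 - 2 * s) (fun τ => E (u τ)) t) +
        ∫ t in Ioi (0 : ℝ), deriv φ t • toAntidual ι (powMul (1 - 2 * s) u' t) = 0) :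
    ∃ y, IsHarmonicPair ι E s x y u u' := by
  have mE := memLp_powMul_form E mu
  obtain ⟨y, hy⟩ := (isWeakDeriv_of_forall_test hs₁ hs₁
    (memLp_powMul_clm (toAntidual ι) (memLp_powMul_conormal mu')) mE fun φ hφ hc hs => by
      rw [add_comm]; exact h φ hφ hc hs).exists_isPrimitive (integrableOn_Ioc_of_memLp hs₁ mE)
  exact ⟨y, mu, mu', pu, hy⟩

variable [CompleteSpace V] [CompleteSpace H]

open scoped FourierTransform in
/-- Existence for the Dirichlet problem: an arbitrary extension of `x` is corrected by the solution
of the variational problem with zero initial value. -/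
theorem exists_isHarmonicPair_dirichlet {μ : ℝ} (hμ : 0 < μ)
    (hE : ∀ u : V, μ * ‖u‖ ^ 2 ≤ (E u u).re) (hs₀ : 0 < s) (hs₁ : s < 1)
    (hx : x ∈ complexInterp (ContinuousLinearMap.id ℂ H) ι s) :
    ∃ u u' y, IsHarmonicPair ι E s x y u u' := by
  obtain ⟨Φ, Φ', mΦ, mΦ', pΦ⟩ :=
    exists_isPrimitive_of_mem_complexInterp (fun g => memLp_fourier) ι hs₀ hs₁ hx
  obtain ⟨z, z', mz, mz', hz1, hz2⟩ := exists_variational_solution ι E hμ hE hs₀ hs₁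
    (fun _ => True) (memLp_powMul_form E mΦ) (memLp_powMul_conormal mΦ')
  obtain ⟨x₀, pz⟩ := (isWeakDeriv_of_forall_test (by linarith) (by linarith)
    (memLp_powMul_clm ι mz) mz' fun φ hφ hc _ => hz1 φ hφ hc trivial).exists_isPrimitive
      (integrableOn_Ioc_of_memLp (by linarith) mz')
  obtain rfl : x₀ = 0 := by
    obtain ⟨φ, hφ, hc, h1⟩ := exists_testFunction_zero_eq_one
    have := hz1 φ hφ hc trivial
    rw [pz.integral_deriv_smul hφ hc] at this
    simpa [h1] using this
  have pu := (pΦ.sub pz).congr (u₂ := fun t => ι (Φ t - z t))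
    (Eventually.of_forall fun t => by simp) EventuallyEq.rfl
  rw [sub_zero] at pu
  refine ⟨_, _, exists_isHarmonicPair_of_forall_test hs₁ (memLp_powMul_sub mΦ mz)
    (memLp_powMul_sub mΦ' mz') pu fun φ hφ hc hs => ?_⟩
  have hφ0 : φ 0 = 0 := zero_of_tsupport_subset hs le_rfl
  have e := hz2 φ hφ hc fun ψ _ => by rw [hφ0, mul_zero]
  have a1 : ∀ {f : ℝ → V}, MemLp (powMul (1 - s) f) 2 starMeasure → IntegrableOn
      (fun t => φ t • powMul (1 - 2 * s) (fun τ => E (f τ)) t) (Ioi 0) := fun m =>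
    integrableOn_smul_of_tsupport hφ.continuous hc hs
      (locallyIntegrableOn_of_memLp hs₁ (memLp_powMul_form E m))
  have a2 : ∀ {f : ℝ → H}, MemLp (powMul (1 - s) f) 2 starMeasure → IntegrableOn
      (fun t => deriv φ t • toAntidual ι (powMul (1 - 2 * s) f t)) (Ioi 0) := fun m =>
    integrableOn_smul_of_tsupport (hφ.continuous_deriv (by simp)) hc.deriv
      (tsupport_deriv_subset.trans hs)
      (locallyIntegrableOn_of_memLp hs₁ (memLp_powMul_clm _ (memLp_powMul_conormal m)))
  have e1 : ∀ t, φ t • powMul (1 - 2 * s) (fun τ => E (Φ τ - z τ)) t =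
      φ t • powMul (1 - 2 * s) (fun τ => E (Φ τ)) t -
        φ t • powMul (1 - 2 * s) (fun τ => E (z τ)) t := fun t => by
    simp only [powMul, map_sub, smul_sub]
  have e2 : ∀ t, deriv φ t • toAntidual ι (powMul (1 - 2 * s) (fun τ => Φ' τ - z' τ) t) =
      deriv φ t • toAntidual ι (powMul (1 - 2 * s) Φ' t) -
        deriv φ t • toAntidual ι (powMul (1 - 2 * s) z' t) := fun t => by
    simp only [powMul, map_sub, smul_sub]
  simp only [e1, e2]
  rw [integral_sub (a1 mΦ) (a1 mz), integral_sub (a2 mΦ') (a2 mz'), sub_add_sub_comm, e, sub_self]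

open scoped FourierTransform in
/-- Existence for the Neumann problem: the functional `v ↦ ⟨y, v(0)⟩` is continuous on the form
domain because `y` is the initial value of a function `w` with weighted square integrable
`w` and `w'`, so that it equals `-∫ (⟨w', v⟩ + (w | v')) dt`. -/
theorem exists_isHarmonicPair_neumann {μ : ℝ} (hμ : 0 < μ)
    (hE : ∀ u : V, μ * ‖u‖ ^ 2 ≤ (E u u).re) (hs₀ : 0 < s) (hs₁ : s < 1)
    (hy : y ∈ complexInterp (toAntidual ι) (ContinuousLinearMap.id ℂ (V →L⋆[ℂ] ℂ)) s) :
    ∃ u u' x, IsHarmonicPair ι E s x (-y) u u' := by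
  obtain ⟨w, w', mw, mw', pw⟩ := exists_isPrimitive_of_mem_complexInterp
    (fun g => memLp_fourier_antidual) (toAntidual ι) (θ := 1 - s) (by linarith) (by linarith)
    (mem_complexInterp_symm hy)
  rw [sub_sub_cancel] at mw mw'
  obtain ⟨u, u', mu, mu', hu1, hu2⟩ := exists_variational_solution ι E hμ hE hs₀ hs₁
    (fun φ => tsupport φ ⊆ Ioi 0) (memLp_powMul_neg mw') (memLp_powMul_neg mw)
  have key : ∀ φ : ℝ → ℂ, ContDiff ℝ ∞ φ → HasCompactSupport φ →
      (∫ t in Ioi (0 : ℝ), φ t • powMul (1 - 2 * s) (fun τ => E (u τ)) t) +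
        ∫ t in Ioi (0 : ℝ), deriv φ t • toAntidual ι (powMul (1 - 2 * s) u' t) = φ 0 • y := by
    intro φ hφ hc
    rw [hu2 φ hφ hc fun ψ hψ => by rw [zero_of_tsupport_subset hψ le_rfl, zero_mul]]
    simp only [map_neg, smul_neg, integral_neg]
    rw [pw.integral_deriv_smul hφ hc]
    abel
  obtain ⟨x, pu⟩ := (isWeakDeriv_of_forall_test (by linarith) (by linarith)
    (memLp_powMul_clm ι mu) mu' hu1).exists_isPrimitive
      (integrableOn_Ioc_of_memLp (by linarith) mu')
  obtain ⟨y₀, h⟩ := exists_isHarmonicPair_of_forall_test (E := E) hs₁ mu mu' pu fun φ hφ hc hs => by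
    rw [key φ hφ hc, zero_of_tsupport_subset hs le_rfl]; exact zero_smul ℂ y
  obtain rfl : y₀ = -y := by
    obtain ⟨φ, hφ, hc, h1⟩ := exists_testFunction_zero_eq_one
    have := key φ hφ hc
    rw [h.conormal.integral_deriv_smul hφ hc] at this
    rw [← neg_eq_iff_eq_neg]
    simpa [h1] using this
  exact ⟨u, u', x, h⟩

end Harmonic

end ExtensionProblem

theorem theorem4p4 {H V : Type*}
    [NormedAddCommGroup H] [InnerProductSpace ℂ H] [CompleteSpace H]
    [NormedAddCommGroup V] [InnerProductSpace ℂ V] [CompleteSpace V]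
    (ι : V →L[ℂ] H) (hι : Function.Injective ι) (hι_dense : DenseRange ι)
    (E : V →L[ℂ] (V →L⋆[ℂ] ℂ))
    (hE : ∃ μ : ℝ, 0 < μ ∧ ∀ u : V, μ * ‖u‖ ^ 2 ≤ (E u u).re)
    (s : ℝ) (hs₀ : 0 < s) (hs₁ : s < 1) :
    (∀ x ∈ ExtensionProblem.complexInterp (ContinuousLinearMap.id ℂ H) ι s,
      ∃! u : ℝ →ₘ[volume.restrict (Ioi 0)] V,
        ExtensionProblem.IsHarmonic ι E s u ∧
        ExtensionProblem.HasTrace (fun t => ι (u t)) x) ∧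
    (∀ y ∈ ExtensionProblem.complexInterp (ExtensionProblem.toAntidual ι)
        (ContinuousLinearMap.id ℂ (V →L⋆[ℂ] ℂ)) s,
      ∃! u : ℝ →ₘ[volume.restrict (Ioi 0)] V,
        ExtensionProblem.IsHarmonic ι E s u ∧
        ExtensionProblem.HasNormalDeriv ι s u y) := by
  obtain ⟨μ, hμ, hE⟩ := hE
  have mk : ∀ {x y} {u : ℝ → V} {u'}, ExtensionProblem.IsHarmonicPair ι E s x y u u' →
      ∃ v : ℝ →ₘ[volume.restrict (Ioi 0)] V, ExtensionProblem.IsHarmonicPair ι E s x y v u' := fun h =>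
    ⟨AEEqFun.mk _ (ExtensionProblem.aestronglyMeasurable_of_memLp_powMul h.memLp),
      h.congr (AEEqFun.coeFn_mk _ _).symm⟩
  have uniq : ∀ {x x₂ y y₂ u' v'} {u v : ℝ →ₘ[volume.restrict (Ioi 0)] V},
      ExtensionProblem.IsHarmonicPair ι E s x y u u' → ExtensionProblem.IsHarmonicPair ι E s x₂ y₂ v v' → (x = x₂ ∨ y = y₂) →
      u = v := fun h h₂ hxy => by
    have h0 := (h.sub h₂).ae_eq_zero hι hι_dense hμ hE (hxy.imp sub_eq_zero.2 sub_eq_zero.2)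
    exact AEEqFun.ext (by filter_upwards [h0] with t ht using sub_eq_zero.1 ht)
  refine ⟨fun x hx => ?_, fun y hy => ?_⟩
  · obtain ⟨u₀, u', y, h₀⟩ := ExtensionProblem.exists_isHarmonicPair_dirichlet hμ hE hs₀ hs₁ hx
    obtain ⟨u, h⟩ := mk h₀
    refine ⟨u, ⟨h.isHarmonic hs₀ hs₁, h.primitive.hasTrace⟩, fun v hv => ?_⟩
    obtain ⟨v', x₂, y₂, h₂⟩ := hv.1.exists_isHarmonicPair hs₀ hs₁
    exact uniq h₂ h (Or.inl (h₂.primitive.eq_of_hasTrace hv.2).symm)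
  · obtain ⟨u₀, u', x, h₀⟩ := ExtensionProblem.exists_isHarmonicPair_neumann hμ hE hs₀ hs₁ hy
    obtain ⟨u, h⟩ := mk h₀
    refine ⟨u, ⟨h.isHarmonic hs₀ hs₁, by simpa using h.hasNormalDeriv⟩, fun v hv => ?_⟩
    obtain ⟨v', x₂, y₂, h₂⟩ := hv.1.exists_isHarmonicPair hs₀ hs₁
    exact uniq h₂ h (Or.inr (h₂.eq_of_hasNormalDeriv hv.2))
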